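/- Let $n\ge 3$ and let $K\subset\mathbb{R}^n$ be a convex body, i.e. a compact convex set with nonempty interior, whose centroid $\frac{1}{V(K)}\int_K x\,dx$ is the origin. Write $V=V(K)$ for its volume. Let $\partial' K$ be the set of boundary points of $K$ at which the outer unit normal $\nu(x)$ is unique, and let $\mu$ be the cone-volume measure of $K$, the Borel measure on $\mathbb{S}^{n-1}$ given by $$\mu(\omega)=\frac1n\int_{\{x\in\partial' K\,:\,\nu(x)\in\omega\}} x\cdot\nu(x)\,d\mathcal{H}^{n-1}(x),$$ where $\mathcal{H}^{n-1}$ is the $(n-1)$-dimensional Hausdorff measure (so that $\mu(\mathbb{S}^{n-1})=V(K)$). Write $\mu(u)$ for $\mu(\{u\})$. Then for every $u\in\mathbb{S}^{n-1}$, $$n\,\frac{\mu(u)+\mu(-u)}{V}+(n+1)^{n-1}\left|\frac{\mu(u)-\mu(-u)}{V}\right|^n\le 1 .$$ Moreover, if equality holds for some $u\in\mathbb{S}^{n-1}$, then there is an $(n-1)$-dimensional convex body $P$ (a compact convex set of dimension $n-1$) lying in a hyperplane $H$ perpendicular to $u$ such that $K$ is - either an oblique prism $K=\operatorname{conv}\bigl(P\cup(P+l)\bigr)$,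 where the translation vector $l\in\mathbb{R}^n$ is not parallel to $H$ (that is, $u\cdot l\neq 0$), - or a cone $K=\operatorname{conv}(P\cup\{p\})$, where $p\in\mathbb{R}^n\setminus H$. Here $\operatorname{conv}$ denotes the convex hull. -/

import Mathlib

open MeasureTheory Metric
open scoped RealInnerProductSpace ENNReal

noncomputable section

namespace LogMinkowski

variable {n : ℕ}

/-- The unit vector `v` is an outer normal of `K` at `x`: the half-space
`{y | ⟪y, v⟫ ≤ ⟪x, v⟫}` contains `K`. -/
def IsOuterUnitNormal (K : ConvexBody (EuclideanSpace ℝ (Fin n))) (x : EuclideanSpace ℝ (Fin n))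
    (v : sphere (0 : EuclideanSpace ℝ (Fin n)) 1) : Prop :=
  ∀ y ∈ K, ⟪y, (v : EuclideanSpace ℝ (Fin n))⟫ ≤ ⟪x, (v : EuclideanSpace ℝ (Fin n))⟫

/-- The set `∂'K` of the boundary points of `K` at which the outer unit normal is unique. -/
def regularBoundary (K : ConvexBody (EuclideanSpace ℝ (Fin n))) :
    Set (EuclideanSpace ℝ (Fin n)) :=
  {x | x ∈ frontier (K : Set (EuclideanSpace ℝ (Fin n))) ∧ ∃! v, IsOuterUnitNormal K x v}

/-- The Gauss map `ν : ∂'K → 𝕊ⁿ⁻¹`. -/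
def gaussMap (K : ConvexBody (EuclideanSpace ℝ (Fin n))) (x : regularBoundary K) :
    sphere (0 : EuclideanSpace ℝ (Fin n)) 1 :=
  x.2.2.choose

/-- The cone-volume measure of a convex body `K` in `ℝⁿ` with the origin in its interior,
`μ(ω) = (1/n) ∫_{ν⁻¹(ω)} ⟪x, ν(x)⟫ dℋⁿ⁻¹(x)`, as a measure on the unit sphere. Here `μHE[n - 1]`
is the `(n-1)`-dimensional Hausdorff measure with the usual normalization, in which it is
Lebesgue measure on hyperplanes; `comap` is its restriction to `∂'K`. -/
def coneVolumeMeasure (K : ConvexBody (EuclideanSpace ℝ (Fin n))) :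
    Measure (sphere (0 : EuclideanSpace ℝ (Fin n)) 1) :=
  ((n : ℝ≥0∞)⁻¹ •
    ((μHE[n - 1] : Measure (EuclideanSpace ℝ (Fin n))).comap
      (Subtype.val : regularBoundary K → EuclideanSpace ℝ (Fin n))).withDensity
        (fun x => ENNReal.ofReal
          ⟪(x : EuclideanSpace ℝ (Fin n)), (gaussMap K x : EuclideanSpace ℝ (Fin n))⟫)).map
    (gaussMap K)

/-- The centroid `(1 / V(K)) ∫_K x dx` of `K`. -/
def centroid (K : ConvexBody (EuclideanSpace ℝ (Fin n))) : EuclideanSpace ℝ (Fin n) :=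
  (volume.real (K : Set (EuclideanSpace ℝ (Fin n))))⁻¹ •
    ∫ x in (K : Set (EuclideanSpace ℝ (Fin n))), x

/-- `P` is an `(n-1)`-dimensional convex body in the hyperplane `{x | ⟪u, x⟫ = c}`, which is
perpendicular to the unit vector `u`. -/
def IsHyperplaneBody (P : ConvexBody (EuclideanSpace ℝ (Fin n)))
    (u : sphere (0 : EuclideanSpace ℝ (Fin n)) 1) (c : ℝ) : Prop :=
  (P : Set (EuclideanSpace ℝ (Fin n))) ⊆ {x | ⟪(u : EuclideanSpace ℝ (Fin n)), x⟫ = c} ∧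
    Module.finrank ℝ (vectorSpan ℝ (P : Set (EuclideanSpace ℝ (Fin n)))) = n - 1

/-- `K = conv (P ∪ (P + l))` for an `(n-1)`-dimensional convex body `P` in a hyperplane
perpendicular to `u` and a translation vector `l` that is not parallel to this hyperplane. -/
def IsObliquePrism (K : ConvexBody (EuclideanSpace ℝ (Fin n)))
    (u : sphere (0 : EuclideanSpace ℝ (Fin n)) 1) : Prop :=
  ∃ (P : ConvexBody (EuclideanSpace ℝ (Fin n))) (c : ℝ) (l : EuclideanSpace ℝ (Fin n)),
    IsHyperplaneBody P u c ∧ ⟪(u : EuclideanSpace ℝ (Fin n)), l⟫ ≠ 0 ∧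
      (K : Set (EuclideanSpace ℝ (Fin n))) =
        convexHull ℝ ((P : Set (EuclideanSpace ℝ (Fin n))) ∪ (fun x => x + l) '' (P : Set _))

/-- `K = conv (P ∪ {p})` for an `(n-1)`-dimensional convex body `P` in a hyperplane
perpendicular to `u` and a point `p` outside this hyperplane. -/
def IsCone (K : ConvexBody (EuclideanSpace ℝ (Fin n)))
    (u : sphere (0 : EuclideanSpace ℝ (Fin n)) 1) : Prop :=
  ∃ (P : ConvexBody (EuclideanSpace ℝ (Fin n))) (c : ℝ) (p : EuclideanSpace ℝ (Fin n)),
    IsHyperplaneBody P u c ∧ ⟪(u : EuclideanSpace ℝ (Fin n)), p⟫ ≠ c ∧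
      (K : Set (EuclideanSpace ℝ (Fin n))) =
        convexHull ℝ ((P : Set (EuclideanSpace ℝ (Fin n))) ∪ {p})

/-! The remaining facts show that the objects above are measurable, so that the cone-volume
measure is given by the expected formula and takes finite values at points. -/

theorem isOuterUnitNormal_gaussMap (K : ConvexBody (EuclideanSpace ℝ (Fin n)))
    (x : regularBoundary K) : IsOuterUnitNormal K x (gaussMap K x) :=
  x.2.2.choose_spec.1

theorem gaussMap_eq (K : ConvexBody (EuclideanSpace ℝ (Fin n))) (x : regularBoundary K)
    {v : sphere (0 : EuclideanSpace ℝ (Fin n)) 1} (hv : IsOuterUnitNormal K x v) :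
    gaussMap K x = v :=
  (x.2.2.choose_spec.2 v hv).symm

theorem isClosed_isOuterUnitNormal (K : ConvexBody (EuclideanSpace ℝ (Fin n))) :
    IsClosed {q : EuclideanSpace ℝ (Fin n) × sphere (0 : EuclideanSpace ℝ (Fin n)) 1 |
      IsOuterUnitNormal K q.1 q.2} := by
  simp only [IsOuterUnitNormal, Set.ofPred_forall]
  exact isClosed_iInter fun y => isClosed_iInter fun _ =>
    isClosed_le (by fun_prop) (by fun_prop)

theorem isCompact_normals (K : ConvexBody (EuclideanSpace ℝ (Fin n))) :
    IsCompact {q : EuclideanSpace ℝ (Fin n) × sphere (0 : EuclideanSpace ℝ (Fin n)) 1 |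
      q.1 ∈ K ∧ IsOuterUnitNormal K q.1 q.2} := by
  refine ((K.isCompact.prod isCompact_univ).inter_right
    (isClosed_isOuterUnitNormal K)).of_isClosed_subset ?_ ?_
  · exact (K.isClosed.preimage continuous_fst).inter (isClosed_isOuterUnitNormal K)
  · rintro q ⟨h1, h2⟩
    exact ⟨⟨h1, trivial⟩, h2⟩

theorem regularBoundary_subset (K : ConvexBody (EuclideanSpace ℝ (Fin n))) :
    regularBoundary K ⊆ K :=
  fun _ hx => K.isClosed.frontier_subset hx.1

theorem continuous_gaussMap (K : ConvexBody (EuclideanSpace ℝ (Fin n))) :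
    Continuous (gaussMap K) := by
  rw [continuous_iff_isClosed]
  intro s hs
  have hc := ((isCompact_normals K).inter_right (hs.preimage continuous_snd)).image continuous_fst
  convert hc.isClosed.preimage (continuous_subtype_val (p := fun x => x ∈ regularBoundary K))
    using 1
  ext x
  constructor
  · intro hx
    exact ⟨(x, gaussMap K x), ⟨⟨regularBoundary_subset K x.2, isOuterUnitNormal_gaussMap K x⟩,
      hx⟩, rfl⟩
  · rintro ⟨⟨a, v⟩, ⟨⟨_, h2⟩, h3⟩, h4⟩
    simp only at h2 h3 h4
    subst h4
    have := gaussMap_eq K x h2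
    simpa [this] using h3

theorem measurableSet_regularBoundary (K : ConvexBody (EuclideanSpace ℝ (Fin n))) :
    MeasurableSet (regularBoundary K) := by
  let C : ℕ → Set (EuclideanSpace ℝ (Fin n) ×
      sphere (0 : EuclideanSpace ℝ (Fin n)) 1 × sphere (0 : EuclideanSpace ℝ (Fin n)) 1) :=
    fun k => {q | q.1 ∈ K ∧ IsOuterUnitNormal K q.1 q.2.1 ∧ IsOuterUnitNormal K q.1 q.2.2 ∧
      1 / ((k : ℝ) + 1) ≤ dist q.2.1 q.2.2}
  have hC : ∀ k, IsCompact (C k) := by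
    intro k
    refine (K.isCompact.prod isCompact_univ).of_isClosed_subset ?_ (fun q hq => ⟨hq.1, trivial⟩)
    exact (K.isClosed.preimage continuous_fst).inter (((isClosed_isOuterUnitNormal K).preimage
      (continuous_fst.prodMk (continuous_fst.comp continuous_snd))).inter
      (((isClosed_isOuterUnitNormal K).preimage
      (continuous_fst.prodMk (continuous_snd.comp continuous_snd))).inter
      (isClosed_le continuous_const ((continuous_fst.comp continuous_snd).dist
        (continuous_snd.comp continuous_snd)))))
  have key : regularBoundary K = (frontier (K : Set (EuclideanSpace ℝ (Fin n))) ∩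
      Prod.fst '' {q : EuclideanSpace ℝ (Fin n) × sphere (0 : EuclideanSpace ℝ (Fin n)) 1 |
        q.1 ∈ K ∧ IsOuterUnitNormal K q.1 q.2}) \ ⋃ k, Prod.fst '' C k := by
    ext x
    constructor
    · rintro ⟨h1, v, hv, huniq⟩
      refine ⟨⟨h1, (x, v), ⟨K.isClosed.frontier_subset h1, hv⟩, rfl⟩, ?_⟩
      simp only [Set.mem_iUnion, not_exists]
      rintro k ⟨⟨a, w, z⟩, ⟨_, hw, hz, hd⟩, rfl⟩
      rw [huniq w hw, huniq z hz, dist_self] at hd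
      have : 0 < 1 / ((k : ℝ) + 1) := by positivity
      linarith
    · rintro ⟨⟨h1, ⟨a, v⟩, ⟨h2, h3⟩, rfl⟩, h4⟩
      refine ⟨h1, v, h3, fun w hw => ?_⟩
      by_contra hne
      obtain ⟨k, hk⟩ := exists_nat_one_div_lt (dist_pos.2 hne)
      exact h4 (Set.mem_iUnion.2 ⟨k, (a, w, v), ⟨h2, hw, h3, hk.le⟩, rfl⟩)
  rw [key]
  exact (isClosed_frontier.measurableSet.inter
    ((isCompact_normals K).image continuous_fst).measurableSet).diff
      (MeasurableSet.iUnion fun k => ((hC k).image continuous_fst).measurableSet)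

theorem coneVolumeMeasure_apply (K : ConvexBody (EuclideanSpace ℝ (Fin n)))
    {ω : Set (sphere (0 : EuclideanSpace ℝ (Fin n)) 1)} (hω : MeasurableSet ω) :
    coneVolumeMeasure K ω = (n : ℝ≥0∞)⁻¹ * ∫⁻ x in gaussMap K ⁻¹' ω, ENNReal.ofReal
        ⟪(x : EuclideanSpace ℝ (Fin n)), (gaussMap K x : EuclideanSpace ℝ (Fin n))⟫
      ∂((μHE[n - 1] : Measure (EuclideanSpace ℝ (Fin n))).comap Subtype.val) := by
  have hm := (continuous_gaussMap K).measurable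
  rw [coneVolumeMeasure, Measure.map_apply hm hω, Measure.smul_apply,
    withDensity_apply _ (hm hω), smul_eq_mul]

/-- The cone-volume measure of a single direction is finite. -/
theorem coneVolumeMeasure_singleton_lt_top (K : ConvexBody (EuclideanSpace ℝ (Fin n)))
    (u : sphere (0 : EuclideanSpace ℝ (Fin n)) 1) : coneVolumeMeasure K {u} < ∞ := by
  have hn : n ≠ 0 := by
    rintro rfl
    have h := u.2
    rw [mem_sphere_zero_iff_norm, Subsingleton.elim (u : EuclideanSpace ℝ (Fin 0)) 0,
      norm_zero] at h
    exact zero_ne_one h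
  obtain ⟨m, rfl⟩ := Nat.exists_eq_succ_of_ne_zero hn
  have hm := (continuous_gaussMap K).measurable
  obtain ⟨R, hR⟩ := K.isCompact.isBounded.exists_norm_le
  rw [coneVolumeMeasure_apply K (measurableSet_singleton u)]
  refine ENNReal.mul_lt_top (by simp) ?_
  refine lt_of_le_of_lt (setLIntegral_mono' (g := fun _ => ENNReal.ofReal R)
    (hm (measurableSet_singleton u)) (fun x _ => ?_)) ?_
  · refine ENNReal.ofReal_le_ofReal ((real_inner_le_norm _ _).trans ?_)
    rw [mem_sphere_zero_iff_norm.1 (gaussMap K x).2, mul_one]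
    exact hR x (regularBoundary_subset K x.2)
  rw [setLIntegral_const]
  refine ENNReal.mul_lt_top ENNReal.ofReal_lt_top ?_
  rw [(MeasurableEmbedding.subtype_coe (measurableSet_regularBoundary K)).comap_apply]
  -- all the points concerned lie on one hyperplane
  rcases (gaussMap K ⁻¹' {u}).eq_empty_or_nonempty with he | ⟨x₀, hx₀⟩
  · simp [he]
  have hin : ∀ x ∈ gaussMap K ⁻¹' {u}, (x : EuclideanSpace ℝ (Fin (m + 1))) - x₀ ∈
      (ℝ ∙ (u : EuclideanSpace ℝ (Fin (m + 1))))ᗮ := by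
    intro x hx
    rw [Submodule.mem_orthogonal_singleton_iff_inner_left, inner_sub_left, sub_eq_zero]
    have h1 := isOuterUnitNormal_gaussMap K x x₀ (regularBoundary_subset K x₀.2)
    have h2 := isOuterUnitNormal_gaussMap K x₀ x (regularBoundary_subset K x.2)
    rw [show gaussMap K x = u from hx] at h1
    rw [show gaussMap K x₀ = u from hx₀] at h2
    exact le_antisymm h2 h1
  have hfr : Module.finrank ℝ (ℝ ∙ (u : EuclideanSpace ℝ (Fin (m + 1))))ᗮ = m := by
    have : Fact (Module.finrank ℝ (EuclideanSpace ℝ (Fin (m + 1))) = m + 1) := ⟨by simp⟩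
    exact Submodule.finrank_orthogonal_span_singleton (by
      intro h
      have := mem_sphere_zero_iff_norm.1 u.2
      rw [h, norm_zero] at this
      exact zero_ne_one this)
  let f : (ℝ ∙ (u : EuclideanSpace ℝ (Fin (m + 1))))ᗮ → EuclideanSpace ℝ (Fin (m + 1)) :=
    fun w => w + x₀
  have hf : Isometry f := (IsometryEquiv.addRight (x₀ : EuclideanSpace ℝ (Fin (m + 1)))).isometry.comp
    isometry_subtype_coe
  have hsub : Subtype.val '' (gaussMap K ⁻¹' {u}) ⊆ f '' closedBall 0 (R + R) := by
    rintro _ ⟨x, hx, rfl⟩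
    refine ⟨⟨_, hin x hx⟩, ?_, by simp [f]⟩
    rw [mem_closedBall_zero_iff]
    exact (norm_sub_le _ _).trans (add_le_add (hR x (regularBoundary_subset K x.2))
      (hR x₀ (regularBoundary_subset K x₀.2)))
  refine (measure_mono hsub).trans_lt ?_
  change μHE[m] (f '' closedBall 0 (R + R)) < ∞
  rw [hf.euclideanHausdorffMeasure_image]
  have hv := InnerProductSpace.euclideanHausdorffMeasure_eq_volume
    (V := (ℝ ∙ (u : EuclideanSpace ℝ (Fin (m + 1))))ᗮ)
  rw [hfr] at hv
  rw [hv]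
  exact measure_closedBall_lt_top

end LogMinkowski

end

/-! Cut `K` by hyperplanes perpendicular to `u` and put `m = n - 1`. With the heights rescaled to
`[0, 1]`, Brunn's theorem makes the `m`-th root `g` of the section volume concave. If `V = ∫ g ^ m`
and `W = ∫ s * g s ^ m`, the centroid lies at height `W / V`, so the cones over the two end sections
have normalised volumes `(V - W) * g 1 ^ m / ((m + 1) * V ^ 2)` and `W * g 0 ^ m / ((m + 1) * V ^
2)`. The claim is now about concave functions on an interval.

For given `V` and `W` the extremal profile is affine, that is, a truncated cone `κ * (r + (1 - r) *
s)`, possibly reflected. The difference of `g` and this profile is concave; if it were positive at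
an endpoint it would change sign at most once, and equal masses would force different first moments
(`endpoint_le_of_moments_eq`). Hence both cone volumes of `g` are at most those of the truncated
cone. Because of the term `|x - y| ^ n`, `oppositeConeSum` is not monotone everywhere, but it is
monotone below any point where it is at most `1` (`oppositeConeSum_mono`). For the same reason the
cone-volume measure only has to be bounded above by the cones over the facets. Truncated cones are
settled by `truncated_cone_inequality`, strict for `0 < r < 1`; the ends `r = 0` and `r = 1` are the
cone and the prism.

Equality forces the end values of the profile. In the cone case, the hull of a facet and one point
of the opposite face already has full volume. In the prism case, both facets and the middle section
have equal volume, and the equality case of Brunn–Minkowski (`exists_translate_of_volume_eq`) makes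
the facets translates. That case is proved by comparing the distributions of linear functionals on
the two bodies (`IsStrictCDF.exists_shift`) and separating points by hyperplanes. -/

/-! ### The Brunn–Minkowski inequality, via Prékopa–Leindler. -/

/-- The one-dimensional Brunn–Minkowski inequality for compact sets. -/
theorem volume_add_volume_le_of_isCompact {A B C : Set ℝ} (hA : IsCompact A) (hB : IsCompact B)
    (hA' : A.Nonempty) (hB' : B.Nonempty) (h : ∀ x ∈ A, ∀ y ∈ B, x + y ∈ C) :
    volume A + volume B ≤ volume C := by
  -- With `a = max A` and `b = min B`, the translates `A + b` and `a + B` both lie in `C` and meet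
  -- only at `a + b`.
  obtain ⟨a, ha, hamax⟩ := hA.exists_isGreatest hA'
  obtain ⟨b, hb, hbmin⟩ := hB.exists_isLeast hB'
  have h1 : volume ((fun x => x + b) '' A) = volume A := by
    rw [Set.image_add_right, measure_preimage_add_right]
  have h2 : volume ((fun x => a + x) '' B) = volume B := by
    rw [Set.image_add_left, measure_preimage_add]
  have h3 : AEDisjoint volume ((fun x => x + b) '' A) ((fun x => a + x) '' B) := by
    refine measure_mono_null (t := {a + b}) ?_ (by simp)
    rintro _ ⟨⟨x, hx, rfl⟩, ⟨y, hy, hxy⟩⟩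
    have := hamax hx
    have := hbmin hy
    simp only [Set.mem_singleton_iff] at hxy ⊢
    linarith
  rw [← h1, ← h2, ← measure_union₀ (hB.image (by fun_prop)).measurableSet.nullMeasurableSet h3]
  refine measure_mono ?_
  rintro _ (⟨x, hx, rfl⟩ | ⟨y, hy, rfl⟩)
  · exact h x hx b hb
  · exact h a ha y hy

/-- Inner regularity reduces this to compact subsets; inserting a fixed point of each set keeps the
compact approximants nonempty. -/
theorem volume_add_volume_le {A B C : Set ℝ} (hA : MeasurableSet A) (hB : MeasurableSet B)
    (hA' : A.Nonempty) (hB' : B.Nonempty) (h : ∀ x ∈ A, ∀ y ∈ B, x + y ∈ C) :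
    volume A + volume B ≤ volume C := by
  obtain ⟨a, ha⟩ := hA'
  obtain ⟨b, hb⟩ := hB'
  rw [hA.measure_eq_iSup_isCompact, hB.measure_eq_iSup_isCompact]
  simp only [iSup_and']
  refine ENNReal.biSup_add_biSup_le' (p := fun K => K ⊆ A ∧ IsCompact K)
    (q := fun K => K ⊆ B ∧ IsCompact K) ⟨∅, Set.empty_subset _, isCompact_empty⟩
    ⟨∅, Set.empty_subset _, isCompact_empty⟩ ?_
  rintro K ⟨hK, hK'⟩ L ⟨hL, hL'⟩
  refine (add_le_add (measure_mono (Set.subset_insert a K))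
    (measure_mono (Set.subset_insert b L))).trans ?_
  exact volume_add_volume_le_of_isCompact (hK'.insert a) (hL'.insert b) ⟨a, by simp⟩ ⟨b, by simp⟩
    fun x hx y hy => h x (Set.insert_subset ha hK hx) y (Set.insert_subset hb hL hy)

theorem volume_combo_le {A B C : Set ℝ} (hA : MeasurableSet A) (hB : MeasurableSet B)
    (hA' : A.Nonempty) (hB' : B.Nonempty) {s t : ℝ} (hs : 0 < s) (ht : 0 < t)
    (h : ∀ x ∈ A, ∀ y ∈ B, s * x + t * y ∈ C) :
    ENNReal.ofReal s * volume A + ENNReal.ofReal t * volume B ≤ volume C := by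
  have h1 := Measure.addHaar_smul (volume : Measure ℝ) s A
  have h2 := Measure.addHaar_smul (volume : Measure ℝ) t B
  simp only [Module.finrank_self, pow_one, abs_of_pos hs, abs_of_pos ht] at h1 h2
  rw [← h1, ← h2]
  refine volume_add_volume_le (hA.const_smul₀ s) (hB.const_smul₀ t) hA'.smul_set hB'.smul_set ?_
  rintro _ ⟨x, hx, rfl⟩ _ ⟨y, hy, rfl⟩
  exact h x hx y hy

/-- The one-dimensional Prékopa–Leindler inequality for bounded integrable functions. -/
theorem prekopa_leindler_real {f g h : ℝ → ℝ} (hf : Measurable f) (hg : Measurable g)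
    (hh : Measurable h) (hf0 : 0 ≤ f) (hg0 : 0 ≤ g) (hh0 : 0 ≤ h) (hfb : BddAbove (Set.range f))
    (hgb : BddAbove (Set.range g)) (hfi : Integrable f) (hgi : Integrable g) (hhi : Integrable h)
    {s t : ℝ} (hs : 0 < s) (ht : 0 < t) (hst : s + t = 1)
    (H : ∀ x y, f x ^ s * g y ^ t ≤ h (s * x + t * y)) :
    (∫ x, f x) ^ s * (∫ x, g x) ^ t ≤ ∫ x, h x := by
  by_cases hfz : ∀ x, f x = 0
  · simp only [hfz, integral_zero, Real.zero_rpow hs.ne', zero_mul]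
    exact integral_nonneg hh0
  by_cases hgz : ∀ x, g x = 0
  · simp only [hgz, integral_zero, Real.zero_rpow ht.ne', mul_zero]
    exact integral_nonneg hh0
  push Not at hfz hgz
  obtain ⟨x₀, hx₀⟩ := hfz
  obtain ⟨y₀, hy₀⟩ := hgz
  set a := ⨆ x, f x with ha
  set b := ⨆ x, g x with hb
  have ha0 : 0 < a := (lt_of_le_of_ne (hf0 x₀) (Ne.symm hx₀)).trans_le (le_ciSup hfb x₀)
  have hb0 : 0 < b := (lt_of_le_of_ne (hg0 y₀) (Ne.symm hy₀)).trans_le (le_ciSup hgb y₀)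
  set c := a ^ s * b ^ t with hc
  have hc0 : 0 < c := by positivity
  -- Division by the suprema makes the superlevel sets of `f / a` and `g / b` nonempty at every
  -- level `r < 1`, so the one-dimensional inequality applies; for `r ≥ 1` both are empty.
  -- Integration over `r` then gives an additive bound.
  have key : ∀ r : ℝ, 0 < r → ENNReal.ofReal s * volume {x | r < f x / a}
      + ENNReal.ofReal t * volume {x | r < g x / b} ≤ volume {x | r < h x / c} := by
    intro r hr
    by_cases hr1 : r < 1
    · refine volume_combo_le (measurableSet_lt measurable_const (hf.div_const _))
        (measurableSet_lt measurable_const (hg.div_const _)) ?_ ?_ hs ht ?_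
      · obtain ⟨x, hx⟩ := exists_lt_of_lt_ciSup (show r * a < ⨆ x, f x by nlinarith)
        exact ⟨x, (lt_div_iff₀ ha0).2 hx⟩
      · obtain ⟨x, hx⟩ := exists_lt_of_lt_ciSup (show r * b < ⨆ x, g x by nlinarith)
        exact ⟨x, (lt_div_iff₀ hb0).2 hx⟩
      · intro x hx y hy
        simp only [Set.mem_ofPred_eq] at hx hy ⊢
        rw [lt_div_iff₀ hc0]
        have hx' := (lt_div_iff₀ ha0).1 hx
        have hy' := (lt_div_iff₀ hb0).1 hy
        refine lt_of_lt_of_le ?_ (H x y)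
        calc r * c = (r * a) ^ s * (r * b) ^ t := by
              rw [Real.mul_rpow hr.le ha0.le, Real.mul_rpow hr.le hb0.le, hc]
              have : r ^ s * r ^ t = r := by rw [← Real.rpow_add hr, hst, Real.rpow_one]
              calc _ = (r ^ s * r ^ t) * (a ^ s * b ^ t) := by rw [this]
                _ = _ := by ring
          _ < f x ^ s * g y ^ t :=
            mul_lt_mul'' (Real.rpow_lt_rpow (by positivity) hx' hs)
              (Real.rpow_lt_rpow (by positivity) hy' ht) (by positivity) (by positivity)
    · have h1 : {x | r < f x / a} = ∅ := by
        ext x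
        simp only [Set.mem_ofPred_eq, Set.mem_empty_iff_false, iff_false, not_lt]
        exact ((div_le_one ha0).2 (le_ciSup hfb x)).trans (not_lt.1 hr1)
      have h2 : {x | r < g x / b} = ∅ := by
        ext x
        simp only [Set.mem_ofPred_eq, Set.mem_empty_iff_false, iff_false, not_lt]
        exact ((div_le_one hb0).2 (le_ciSup hgb x)).trans (not_lt.1 hr1)
      rw [h1, h2]
      simp
  have lay : ∀ {φ : ℝ → ℝ} {k : ℝ}, Measurable φ → 0 ≤ φ → 0 < k →
      ∫⁻ x, ENNReal.ofReal (φ x / k) = ∫⁻ r in Set.Ioi (0 : ℝ), volume {x | r < φ x / k} :=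
    fun hφ hφ0 hk => lintegral_eq_lintegral_meas_lt _
      (Filter.Eventually.of_forall fun x => div_nonneg (hφ0 x) hk.le)
      (hφ.div_const _).aemeasurable
  have hanti : ∀ (φ : ℝ → ℝ), Measurable fun r : ℝ => volume {x | r < φ x} := fun φ =>
    Antitone.measurable fun r r' hr => measure_mono fun x hx => lt_of_le_of_lt hr hx
  have key2 : ENNReal.ofReal s * (∫⁻ x, ENNReal.ofReal (f x / a))
      + ENNReal.ofReal t * (∫⁻ x, ENNReal.ofReal (g x / b)) ≤ ∫⁻ x, ENNReal.ofReal (h x / c) := by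
    rw [lay hf hf0 ha0, lay hg hg0 hb0, lay hh hh0 hc0, ← lintegral_const_mul _ (hanti _),
      ← lintegral_const_mul _ (hanti _), ← lintegral_add_left ((hanti _).const_mul _)]
    exact setLIntegral_mono (hanti _) key
  have conv : ∀ {φ : ℝ → ℝ} {k : ℝ}, Integrable φ → 0 ≤ φ → 0 < k →
      ∫⁻ x, ENNReal.ofReal (φ x / k) = ENNReal.ofReal ((∫ x, φ x) / k) := fun hφ hφ0 hk => by
    rw [← integral_div, ofReal_integral_eq_lintegral_ofReal (hφ.div_const _)
      (Filter.Eventually.of_forall fun x => div_nonneg (hφ0 x) hk.le)]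
  rw [conv hfi hf0 ha0, conv hgi hg0 hb0, conv hhi hh0 hc0, ← ENNReal.ofReal_mul hs.le,
    ← ENNReal.ofReal_mul ht.le] at key2
  have hF := integral_nonneg (μ := (volume : Measure ℝ)) hf0
  have hG := integral_nonneg (μ := (volume : Measure ℝ)) hg0
  have hH := integral_nonneg (μ := (volume : Measure ℝ)) hh0
  have hFa := div_nonneg hF ha0.le
  have hGb := div_nonneg hG hb0.le
  rw [← ENNReal.ofReal_add (by positivity) (by positivity), ENNReal.ofReal_le_ofReal_iff
    (div_nonneg hH hc0.le)] at key2
  -- Weighted AM–GM turns the additive bound back into a multiplicative one, in which the factor `c`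
  -- cancels.
  have am := Real.geom_mean_le_arith_mean2_weighted hs.le ht.le hFa hGb hst
  have := (le_div_iff₀ hc0).1 (am.trans key2)
  rw [Real.div_rpow hF ha0.le, Real.div_rpow hG hb0.le, hc] at this
  refine le_of_eq_of_le ?_ this
  field_simp

/-- The multiplicative form of the Brunn–Minkowski inequality for compact sets. -/
theorem brunn_minkowski_mul : ∀ (m : ℕ) {A B M : Set (Fin m → ℝ)}, IsCompact A → IsCompact B →
    IsCompact M → ∀ {s t : ℝ}, 0 < s → 0 < t → s + t = 1 →
    (∀ x ∈ A, ∀ y ∈ B, s • x + t • y ∈ M) →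
    volume.real A ^ s * volume.real B ^ t ≤ volume.real M := by
  intro m
  induction m with
  | zero =>
    intro A B M hA hB hM s t hs ht hst h
    rcases A.eq_empty_or_nonempty with rfl | ⟨x, hx⟩
    · simp [Real.zero_rpow hs.ne']
    rcases B.eq_empty_or_nonempty with rfl | ⟨y, hy⟩
    · simp [Real.zero_rpow ht.ne']
    have e : ∀ {S : Set (Fin 0 → ℝ)} {z}, z ∈ S → volume.real S = 1 := by
      intro S z hz
      have : S = Set.univ := Set.eq_univ_of_forall fun w => by rwa [Subsingleton.elim w z]
      rw [this, Measure.real, ← Set.pi_univ Set.univ, volume_pi, Measure.pi_pi]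
      simp
    rw [e hx, e hy, e (h x hx y hy)]
    simp
  | succ m ih =>
    intro A B M hA hB hM s t hs ht hst h
    let T : (Fin (m + 1) → ℝ) ≃ᵐ ℝ × (Fin m → ℝ) := MeasurableEquiv.piFinSuccAbove (fun _ => ℝ) 0
    have hT : MeasurePreserving T := volume_preserving_piFinSuccAbove (fun _ => ℝ) 0
    have hTs : MeasurePreserving T.symm := hT.symm
    let sl : Set (Fin (m + 1) → ℝ) → ℝ → Set (Fin m → ℝ) :=
      fun S r => {z | Fin.cons (α := fun _ => ℝ) r z ∈ S}
    have hTsymm : ∀ p : ℝ × (Fin m → ℝ), T.symm p = Fin.cons (α := fun _ => ℝ) p.1 p.2 := by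
      intro p
      ext i
      simp [T, MeasurableEquiv.piFinSuccAbove, Fin.insertNthEquiv]
    have hcont : Continuous fun p : ℝ × (Fin m → ℝ) => Fin.cons (α := fun _ => ℝ) p.1 p.2 :=
      Continuous.finCons continuous_fst continuous_snd
    have htail : Continuous fun p : Fin (m + 1) → ℝ => Fin.tail p := by
      unfold Fin.tail; fun_prop
    have slc : ∀ {S}, IsCompact S → ∀ r, IsCompact (sl S r) := by
      intro S hS r
      refine (hS.image htail).of_isClosed_subset
        (hS.isClosed.preimage (hcont.comp (Continuous.prodMk_right r))) ?_
      intro z hz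
      exact ⟨_, hz, by simp⟩
    have mp : ∀ {S}, IsCompact S → MeasurableSet (T.symm ⁻¹' S) :=
      fun hS => T.symm.measurable hS.measurableSet
    have sleq : ∀ S r, Prod.mk r ⁻¹' (T.symm ⁻¹' S) = sl S r := by
      intro S r
      ext z
      simp only [Set.mem_preimage, hTsymm]
      rfl
    have vol : ∀ {S}, IsCompact S → volume S = ∫⁻ r, volume (sl S r) := by
      intro S hS
      rw [← hTs.measure_preimage hS.measurableSet.nullMeasurableSet, Measure.volume_eq_prod,
        Measure.prod_apply (mp hS)]
      simp only [sleq]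
    have meas : ∀ {S}, IsCompact S → Measurable fun r => volume (sl S r) := by
      intro S hS
      have := measurable_measure_prodMk_left (ν := (volume : Measure (Fin m → ℝ))) (mp hS)
      simpa only [sleq] using this
    have fin : ∀ {S}, IsCompact S → ∀ r, volume (sl S r) ≠ ∞ :=
      fun hS r => (slc hS r).measure_ne_top
    have volr : ∀ {S}, IsCompact S → volume.real S = ∫ r, volume.real (sl S r) := by
      intro S hS
      rw [Measure.real, vol hS]
      exact (integral_toReal (meas hS).aemeasurable
        (Filter.Eventually.of_forall fun r => (fin hS r).lt_top)).symm
    have inte : ∀ {S}, IsCompact S → Integrable fun r => volume.real (sl S r) := by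
      intro S hS
      refine integrable_toReal_of_lintegral_ne_top (meas hS).aemeasurable ?_
      rw [← vol hS]
      exact hS.measure_ne_top
    have bdd : ∀ {S}, IsCompact S → BddAbove (Set.range fun r => volume.real (sl S r)) := by
      intro S hS
      refine ⟨volume.real (Fin.tail '' S), ?_⟩
      rintro _ ⟨r, rfl⟩
      refine measureReal_mono ?_ (hS.image htail).measure_ne_top
      intro z hz
      exact ⟨_, hz, by simp⟩
    rw [volr hA, volr hB, volr hM]
    -- By Fubini the volumes are integrals of section volumes, and the induction hypothesis on
    -- sections is the pointwise hypothesis of Prékopa–Leindler.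
    refine prekopa_leindler_real (meas hA).ennreal_toReal (meas hB).ennreal_toReal
      (meas hM).ennreal_toReal (fun _ => measureReal_nonneg) (fun _ => measureReal_nonneg)
      (fun _ => measureReal_nonneg) (bdd hA) (bdd hB) (inte hA) (inte hB) (inte hM) hs ht hst ?_
    intro x y
    refine ih (slc hA x) (slc hB y) (slc hM _) hs ht hst ?_
    intro z hz w hw
    have := h _ hz _ hw
    simp only [sl, Set.mem_ofPred_eq]
    convert this using 1
    ext i
    refine Fin.cases ?_ (fun j => ?_) i <;> simp

section Pointwise

open scoped Pointwise

theorem volume_real_smul_pi {m : ℕ} {r : ℝ} (hr : 0 ≤ r) (A : Set (Fin m → ℝ)) :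
    volume.real (r • A) = r ^ m * volume.real A := by
  rw [Measure.real, Measure.addHaar_smul, Module.finrank_pi, Fintype.card_fin, ENNReal.toReal_mul,
    ENNReal.toReal_ofReal (abs_nonneg _), abs_of_nonneg (by positivity), Measure.real]

/-- The Brunn–Minkowski inequality for compact sets. -/
theorem brunn_minkowski {m : ℕ} (hm : m ≠ 0) {A B M : Set (Fin m → ℝ)} (hA : IsCompact A)
    (hB : IsCompact B) (hM : IsCompact M) (hA' : A.Nonempty) (hB' : B.Nonempty) {s t : ℝ}
    (hs : 0 < s) (ht : 0 < t) (h : ∀ x ∈ A, ∀ y ∈ B, s • x + t • y ∈ M) :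
    s * volume.real A ^ (m⁻¹ : ℝ) + t * volume.real B ^ (m⁻¹ : ℝ) ≤ volume.real M ^ (m⁻¹ : ℝ) := by
  have root : ∀ {v : ℝ}, 0 ≤ v → (v ^ (m⁻¹ : ℝ)) ^ m = v := fun hv => Real.rpow_inv_natCast_pow hv hm
  -- This serves the degenerate case: when one set is null, `M` still contains a translated dilate
  -- of the other.
  have scale : ∀ {r : ℝ} {S : Set (Fin m → ℝ)} (w : Fin m → ℝ), 0 < r →
      (∀ x ∈ S, w + r • x ∈ M) → r * volume.real S ^ (m⁻¹ : ℝ) ≤ volume.real M ^ (m⁻¹ : ℝ) := by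
    intro r S w hr hS
    have h1 : volume.real (r • S) ≤ volume.real M := by
      have : volume.real ((fun x => w + x) '' (r • S)) = volume.real (r • S) := by
        rw [Set.image_add_left, Measure.real, measure_preimage_add, Measure.real]
      rw [← this]
      refine measureReal_mono ?_ hM.measure_ne_top
      rintro _ ⟨_, ⟨x, hx, rfl⟩, rfl⟩
      exact hS x hx
    rw [volume_real_smul_pi hr.le] at h1
    calc r * volume.real S ^ (m⁻¹ : ℝ) = (r ^ m * volume.real S) ^ (m⁻¹ : ℝ) := by
          rw [Real.mul_rpow (by positivity) measureReal_nonneg, Real.pow_rpow_inv_natCast hr.le hm]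
      _ ≤ _ := Real.rpow_le_rpow (by positivity) h1 (by positivity)
  have hm' : (m⁻¹ : ℝ) ≠ 0 := by positivity
  rcases (measureReal_nonneg (μ := volume) (s := A)).eq_or_lt with hvA | hvA
  · obtain ⟨x, hx⟩ := hA'
    rw [← hvA, Real.zero_rpow hm', mul_zero, zero_add]
    exact scale (s • x) ht fun y hy => h x hx y hy
  rcases (measureReal_nonneg (μ := volume) (s := B)).eq_or_lt with hvB | hvB
  · obtain ⟨y, hy⟩ := hB'
    rw [← hvB, Real.zero_rpow hm', mul_zero, add_zero]
    exact scale (t • y) hs fun x hx => by rw [add_comm]; exact h x hx y hy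
  set a := volume.real A ^ (m⁻¹ : ℝ) with ha
  set b := volume.real B ^ (m⁻¹ : ℝ) with hb
  have ha0 : 0 < a := by positivity
  have hb0 : 0 < b := by positivity
  set D := s * a + t * b with hD
  have hD0 : 0 < D := by positivity
  -- Normalised to unit volume, the sets combine with weights `s * a / D` and `t * b / D` inside
  -- `D⁻¹ • M`, so the multiplicative inequality reads `1 ≤ volume.real M / D ^ m`.
  have key := brunn_minkowski_mul m (hA.smul a⁻¹) (hB.smul b⁻¹) (hM.smul D⁻¹)
    (s := s * a / D) (t := t * b / D) (by positivity) (by positivity)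
    (by rw [← add_div, ← hD, div_self hD0.ne']) (by
      rintro _ ⟨x, hx, rfl⟩ _ ⟨y, hy, rfl⟩
      refine ⟨_, h x hx y hy, ?_⟩
      simp only [smul_add, smul_smul]
      congr 2 <;> field_simp)
  rw [volume_real_smul_pi (by positivity), volume_real_smul_pi (by positivity),
    volume_real_smul_pi (by positivity), ← root hvA.le, ← root hvB.le, ← ha, ← hb, ← mul_pow,
    ← mul_pow, inv_mul_cancel₀ ha0.ne', inv_mul_cancel₀ hb0.ne', one_pow, Real.one_rpow,
    Real.one_rpow, one_mul, inv_pow, inv_mul_eq_div, one_le_div (by positivity)] at key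
  have := Real.rpow_le_rpow (by positivity) key (show (0 : ℝ) ≤ (m⁻¹ : ℝ) by positivity)
  rwa [Real.pow_rpow_inv_natCast hD0.le hm] at this

end Pointwise

/-! ### Convex sets charge neighbourhoods of their points. -/

section Convex

variable {E : Type*} [NormedAddCommGroup E] [NormedSpace ℝ E] [MeasurableSpace E]
  (μ : Measure E) [μ.IsOpenPosMeasure]

/-- A convex set with interior lies in the closure of its interior, so an open set meeting it also
meets the interior. -/
theorem Convex.measure_inter_pos {C U : Set E} (hC : Convex ℝ C) (hi : (interior C).Nonempty)
    (hU : IsOpen U) (h : (C ∩ U).Nonempty) : 0 < μ (C ∩ U) := by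
  obtain ⟨x, hx, hxU⟩ := h
  have hcl : x ∈ closure (interior C) := by
    rw [hC.closure_interior_eq_closure_of_nonempty_interior hi]
    exact subset_closure hx
  obtain ⟨y, hyU, hyi⟩ := mem_closure_iff.1 hcl U hU hxU
  exact ((isOpen_interior.inter hU).measure_pos μ ⟨y, hyi, hyU⟩).trans_le
    (measure_mono (Set.inter_subset_inter_left _ interior_subset))

/-- A point of `C` outside the closed set `S` would have a neighbourhood missing `S` in which `C`
has positive measure. This upgrades volume equalities to equalities of sets. -/
theorem Convex.eq_of_subset_of_measure_le [OpensMeasurableSpace E] {S C : Set E}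
    (hC : Convex ℝ C) (hi : (interior C).Nonempty) (hS : IsClosed S) (hSC : S ⊆ C)
    (hfin : μ C ≠ ∞) (h : μ C ≤ μ S) : S = C := by
  refine hSC.antisymm fun x hx => ?_
  by_contra hxS
  have h1 := hC.measure_inter_pos μ hi hS.isOpen_compl ⟨x, hx, hxS⟩
  have h2 : μ (C \ S) = 0 := by
    rw [measure_sdiff hSC hS.measurableSet.nullMeasurableSet (measure_ne_top_of_subset hSC hfin)]
    exact tsub_eq_zero_of_le h
  exact h1.ne' h2

end Convex

/-! ### Distribution functions that agree up to a shift. -/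

/-- A continuous distribution function of total mass `A`, strictly increasing between its
levels `0` and `A`. -/
structure IsStrictCDF (A : ℝ) (F : ℝ → ℝ) : Prop where
  continuous : Continuous F
  mono : Monotone F
  nonneg : ∀ x, 0 ≤ F x
  le_top : ∀ x, F x ≤ A
  exists_eq_zero : ∃ x, F x = 0
  exists_eq_top : ∃ x, F x = A
  strict : ∀ {x y}, x < y → 0 < F x → F x < A → F x < F y

namespace IsStrictCDF

variable {A : ℝ} {F F₀ F₁ Fm : ℝ → ℝ}

theorem exists_eq (h : IsStrictCDF A F) {τ : ℝ} (h0 : 0 < τ) (h1 : τ < A) : ∃ x, F x = τ := by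
  obtain ⟨a, ha⟩ := h.exists_eq_zero
  obtain ⟨b, hb⟩ := h.exists_eq_top
  have hab : a ≤ b := by
    by_contra hba
    have := h.mono (not_le.1 hba).le
    linarith
  obtain ⟨x, -, hx⟩ := intermediate_value_Icc hab h.continuous.continuousOn
    (show τ ∈ Set.Icc (F a) (F b) by rw [ha, hb]; exact ⟨h0.le, h1.le⟩)
  exact ⟨x, hx⟩

theorem le_of_le (h : IsStrictCDF A F) {x y : ℝ} (hxy : F x ≤ F y) (h0 : 0 < F y) (h1 : F y < A) :
    x ≤ y := by
  by_contra hlt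
  exact (h.strict (not_le.1 hlt) h0 h1).not_ge hxy

theorem inj (h : IsStrictCDF A F) {x y : ℝ} (hxy : F x = F y) (h0 : 0 < F y) (h1 : F y < A) :
    x = y :=
  (h.le_of_le hxy.le h0 h1).antisymm (h.le_of_le hxy.ge (by rwa [hxy]) (by rwa [hxy]))

/-- The quantile functions are compared along a geometric progression of levels `τ j`. Since `τ (j +
2) * τ j = τ (j + 1) ^ 2`, the hypothesis bounds a gap of the second quantile function by the next
gap of the first. The gaps telescope, and the offset of one index costs at most `ε`. -/
theorem sub_le_sub (h₀ : IsStrictCDF A F₀) (h₁ : IsStrictCDF A F₁)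
    (H : ∀ {x y}, F₀ x = F₁ y → 0 < F₀ x → F₀ x < A → ∀ e, F₀ (x + e) * F₁ (y - e) ≤ F₀ x ^ 2)
    {x₀ x₁ y₀ y₁ : ℝ} (hx : x₀ < x₁) (hpos : 0 < F₀ x₀) (hlt : F₀ x₁ < A) (e₀ : F₀ x₀ = F₁ y₀)
    (e₁ : F₀ x₁ = F₁ y₁) : y₁ - y₀ ≤ x₁ - x₀ := by
  have hlt0 : F₀ x₀ < F₀ x₁ := h₀.strict hx hpos ((h₀.mono hx.le).trans_lt hlt)
  have hpos1 := hpos.trans hlt0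
  -- Here `p` and `q` are the quantile functions; their value `0` outside `(0, A)` is never used.
  choose p hp using fun τ : ℝ => show ∃ x, 0 < τ → τ < A → F₀ x = τ by
    by_cases h : 0 < τ ∧ τ < A
    · obtain ⟨x, hx⟩ := h₀.exists_eq h.1 h.2
      exact ⟨x, fun _ _ => hx⟩
    · exact ⟨0, fun h1 h2 => (h ⟨h1, h2⟩).elim⟩
  choose q hq using fun τ : ℝ => show ∃ x, 0 < τ → τ < A → F₁ x = τ by
    by_cases h : 0 < τ ∧ τ < A
    · obtain ⟨x, hx⟩ := h₁.exists_eq h.1 h.2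
      exact ⟨x, fun _ _ => hx⟩
    · exact ⟨0, fun h1 h2 => (h ⟨h1, h2⟩).elim⟩
  refine le_of_forall_pos_le_add fun ε hε => ?_
  -- `B` makes room for one further level `τ (N + 1)`, which stays below `A` and has its quantile at
  -- most `x₁ + ε`.
  set B := min (F₀ (x₁ + ε)) ((F₀ x₁ + A) / 2) with hB
  have hB1 : F₀ x₁ < B := lt_min (h₀.strict (by linarith) hpos1 hlt) (by linarith)
  have hBA : B < A := (min_le_right _ _).trans_lt (by linarith)
  set k₀ := Real.log (F₀ x₀)
  set k₁ := Real.log (F₀ x₁)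
  have hk : k₀ < k₁ := Real.log_lt_log hpos hlt0
  have hlB : 0 < Real.log B - k₁ := sub_pos.2 (Real.log_lt_log hpos1 hB1)
  obtain ⟨N, hN⟩ := exists_nat_gt ((k₁ - k₀) / (Real.log B - k₁))
  have hN0 : (0 : ℝ) < N := lt_of_le_of_lt (div_nonneg (by linarith) hlB.le) hN
  set δ := (k₁ - k₀) / N with hδ
  have hδ0 : 0 < δ := div_pos (by linarith) hN0
  have hδB : δ < Real.log B - k₁ := by
    rw [div_lt_iff₀ hlB] at hN
    rw [hδ, div_lt_iff₀ hN0]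
    linarith
  let τ : ℕ → ℝ := fun j => Real.exp (k₀ + j * δ)
  have τpos : ∀ j, 0 < τ j := fun j => Real.exp_pos _
  have τB : ∀ j ≤ N + 1, τ j < B := by
    intro j hj
    have hj' : (j : ℝ) ≤ N + 1 := by exact_mod_cast hj
    rw [← Real.exp_log (hpos1.trans hB1)]
    refine Real.exp_lt_exp.2 ?_
    have : (N : ℝ) * δ = k₁ - k₀ := by rw [hδ]; field_simp
    nlinarith
  have τA : ∀ j ≤ N + 1, τ j < A := fun j hj => (τB j hj).trans hBA
  have τ0 : τ 0 = F₀ x₀ := by simp [τ, k₀, Real.exp_log hpos]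
  have τN : τ N = F₀ x₁ := by
    have : k₀ + (N : ℝ) * δ = k₁ := by rw [hδ]; field_simp; ring
    simp only [τ, this]
    exact Real.exp_log hpos1
  have τmul : ∀ j, τ (j + 2) * τ j = τ (j + 1) ^ 2 := by
    intro j
    simp only [τ]
    rw [← Real.exp_add, ← Real.exp_nat_mul]
    congr 1
    push_cast
    ring
  have step : ∀ j < N, q (τ (j + 1)) - q (τ j) ≤ p (τ (j + 2)) - p (τ (j + 1)) := by
    intro j hj
    have a0 := hq _ (τpos j) (τA j (by omega))
    have a1 := hq _ (τpos (j + 1)) (τA (j + 1) (by omega))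
    have b1 := hp _ (τpos (j + 1)) (τA (j + 1) (by omega))
    have b2 := hp _ (τpos (j + 2)) (τA (j + 2) (by omega))
    -- This displacement makes the first factor `τ (j + 2)`; cancelling it leaves `τ j` as a bound
    -- for the second.
    have := H (b1.trans a1.symm) (by rw [b1]; exact τpos _) (by rw [b1]; exact τA _ (by omega))
      (p (τ (j + 2)) - p (τ (j + 1)))
    rw [b1, add_sub_cancel, b2, ← τmul] at this
    have := le_of_mul_le_mul_left this (τpos _)
    rw [← a0] at this
    have := h₁.le_of_le this (by rw [a0]; exact τpos _) (by rw [a0]; exact τA _ (by omega))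
    linarith
  have sum := Finset.sum_le_sum fun j hj => step j (Finset.mem_range.1 hj)
  rw [Finset.sum_range_sub (fun j => q (τ j)),
    Finset.sum_range_sub (fun j => p (τ (j + 1)))] at sum
  have c0 : q (τ 0) = y₀ := h₁.inj
    (by rw [hq _ (τpos 0) (τA 0 (by omega)), τ0, e₀]) (by rw [← e₀]; exact hpos)
    (by rw [← e₀]; exact hlt0.trans hlt)
  have c1 : q (τ N) = y₁ := h₁.inj
    (by rw [hq _ (τpos N) (τA N (by omega)), τN, e₁]) (by rw [← e₁]; exact hpos1)
    (by rw [← e₁]; exact hlt)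
  have d0 : x₀ ≤ p (τ 1) := by
    have b := hp _ (τpos 1) (τA 1 (by omega))
    refine h₀.le_of_le ?_ (by rw [b]; exact τpos _) (by rw [b]; exact τA _ (by omega))
    rw [b, ← τ0]
    exact Real.exp_le_exp.2 (by simp; exact hδ0.le)
  have d1 : p (τ (N + 1)) ≤ x₁ + ε := by
    have b := hp _ (τpos (N + 1)) (τA (N + 1) le_rfl)
    have hlt' : F₀ (p (τ (N + 1))) < F₀ (x₁ + ε) := by
      rw [b]
      exact (τB _ le_rfl).trans_le (min_le_left _ _)
    by_contra hcon
    exact (h₀.mono (not_le.1 hcon).le).not_gt hlt'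
  simp only [zero_add] at sum
  rw [c0, c1] at sum
  linarith

/-- If two distribution functions satisfy the midpoint inequality against a third one, and so do
their complements, then they differ by a translation. -/
theorem exists_shift (hA : 0 < A) (h₀ : IsStrictCDF A F₀) (h₁ : IsStrictCDF A F₁)
    (hm0 : ∀ x, 0 ≤ Fm x) (hmA : ∀ x, Fm x ≤ A)
    (H₁ : ∀ x y, F₀ x * F₁ y ≤ Fm ((x + y) / 2) ^ 2)
    (H₂ : ∀ x y, (A - F₀ x) * (A - F₁ y) ≤ (A - Fm ((x + y) / 2)) ^ 2) :
    ∃ s, ∀ x, F₁ (x + s) = F₀ x := by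
  -- At a common level the two midpoint inequalities squeeze `Fm` to that level. The pair `x + e`,
  -- `y - e` has the same midpoint, so `H₁` bounds its product by the square of the level.
  have H : ∀ {x y}, F₀ x = F₁ y → ∀ e, F₀ (x + e) * F₁ (y - e) ≤ F₀ x ^ 2 := by
    intro x y hxy e
    have a1 := H₁ x y
    have a2 := H₂ x y
    rw [← hxy, ← sq] at a1 a2
    have b1 := abs_le_of_sq_le_sq' a1 (hm0 _)
    have b2 := abs_le_of_sq_le_sq' a2 (sub_nonneg.2 (hmA _))
    have b3 : Fm ((x + y) / 2) = F₀ x := by linarith [b1.2, b2.2]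
    have := H₁ (x + e) (y - e)
    rwa [show x + e + (y - e) = x + y by ring, b3] at this
  have H' : ∀ {y x}, F₁ y = F₀ x → ∀ e, F₁ (y + e) * F₀ (x - e) ≤ F₁ y ^ 2 := by
    intro y x hxy e
    have := H hxy.symm (-e)
    rwa [sub_neg_eq_add, ← sub_eq_add_neg, mul_comm, ← hxy] at this
  have dist : ∀ {x₀ x₁ y₀ y₁ : ℝ}, x₀ < x₁ → 0 < F₀ x₀ → F₀ x₁ < A → F₀ x₀ = F₁ y₀ →
      F₀ x₁ = F₁ y₁ → y₁ - y₀ = x₁ - x₀ := by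
    intro x₀ x₁ y₀ y₁ hx hpos hlt e₀ e₁
    have hlt0 : F₀ x₀ < F₀ x₁ := h₀.strict hx hpos ((h₀.mono hx.le).trans_lt hlt)
    have hy : y₀ < y₁ := by
      by_contra hy
      have := h₁.mono (not_lt.1 hy)
      linarith
    exact (h₀.sub_le_sub h₁ (fun h _ _ => H h) hx hpos hlt e₀ e₁).antisymm
      (h₁.sub_le_sub h₀ (fun h _ _ => H' h) hy (by rwa [← e₀]) (by rwa [← e₁]) e₀.symm e₁.symm)
  obtain ⟨a, ha⟩ := h₀.exists_eq (half_pos hA) (half_lt_self hA)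
  obtain ⟨b, hb⟩ := h₁.exists_eq (half_pos hA) (half_lt_self hA)
  have main : ∀ {x y}, 0 < F₀ x → F₀ x < A → F₀ x = F₁ y → y = x + (b - a) := by
    intro x y h0 h1 hxy
    rcases lt_trichotomy x a with hlt | rfl | hlt
    · have := dist hlt h0 (by rw [ha]; exact half_lt_self hA) hxy (ha.trans hb.symm)
      linarith
    · have : y = b := h₁.inj (by rw [← hxy, ha, hb]) (by rw [hb]; exact half_pos hA)
        (by rw [hb]; exact half_lt_self hA)
      linarith
    · have := dist hlt (by rw [ha]; exact half_pos hA) h1 (ha.trans hb.symm) hxy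
      linarith
  have inner : ∀ {x}, 0 < F₀ x → F₀ x < A → F₁ (x + (b - a)) = F₀ x := by
    intro x h0 h1
    obtain ⟨y, hy⟩ := h₁.exists_eq h0 h1
    rw [← main h0 h1 hy.symm, hy]
  have inner' : ∀ {x}, 0 < F₁ (x + (b - a)) → F₁ (x + (b - a)) < A →
      F₁ (x + (b - a)) = F₀ x := by
    intro x h0 h1
    obtain ⟨z, hz⟩ := h₀.exists_eq h0 h1
    have := main (by rwa [hz]) (by rwa [hz]) hz
    rw [← hz, show z = x by linarith]
  refine ⟨b - a, fun x => ?_⟩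
  have hba : F₁ (a + (b - a)) = A / 2 := by rw [add_sub_cancel, hb]
  by_cases hi : 0 < F₀ x ∧ F₀ x < A
  · exact inner hi.1 hi.2
  by_cases hi' : 0 < F₁ (x + (b - a)) ∧ F₁ (x + (b - a)) < A
  · exact inner' hi'.1 hi'.2
  -- Neither value lies in the open range here, so both are extreme; the position of `x` relative to
  -- the median `a` decides which extreme.
  rcases le_total x a with hxa | hxa
  · have m0 := h₀.mono hxa
    have m1 := h₁.mono (show x + (b - a) ≤ a + (b - a) by linarith)
    rw [ha] at m0
    rw [hba] at m1
    have e0 : F₀ x = 0 := by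
      by_contra h
      exact hi ⟨(h₀.nonneg x).lt_of_ne' h, by linarith⟩
    have e1 : F₁ (x + (b - a)) = 0 := by
      by_contra h
      exact hi' ⟨(h₁.nonneg _).lt_of_ne' h, by linarith⟩
    rw [e0, e1]
  · have m0 := h₀.mono hxa
    have m1 := h₁.mono (show a + (b - a) ≤ x + (b - a) by linarith)
    rw [ha] at m0
    rw [hba] at m1
    have e0 : F₀ x = A := by
      by_contra h
      exact hi ⟨by linarith, (h₀.le_top x).lt_of_ne h⟩
    have e1 : F₁ (x + (b - a)) = A := by
      by_contra h
      exact hi' ⟨by linarith, (h₁.le_top _).lt_of_ne h⟩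
    rw [e0, e1]

end IsStrictCDF

/-! ### Half-space volumes of convex bodies and equality in Brunn–Minkowski. -/

theorem MeasureTheory.Measure.addHaar_levelSet {E : Type*} [NormedAddCommGroup E] [NormedSpace ℝ E]
    [MeasurableSpace E] [BorelSpace E] [FiniteDimensional ℝ E] (μ : Measure E) [μ.IsAddHaarMeasure]
    {l : E →L[ℝ] ℝ} (hl : l ≠ 0) (c : ℝ) : μ {x | l x = c} = 0 := by
  obtain ⟨w, hw⟩ : ∃ w, l w ≠ 0 := by
    by_contra h
    push Not at h
    exact hl (ContinuousLinearMap.ext h)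
  have h1 : {x | l x = c} = (fun x => x + -((c / l w) • w)) ⁻¹' (LinearMap.ker l.toLinearMap : Set E) := by
    ext x
    simp [hw, ← sub_eq_add_neg, sub_eq_zero]
  rw [h1, measure_preimage_add_right]
  refine Measure.addHaar_submodule _ _ fun h => hw ?_
  have : w ∈ LinearMap.ker l.toLinearMap := h ▸ Submodule.mem_top
  exact this

theorem Convex.nonempty_interior_of_measure_ne_zero {E : Type*} [NormedAddCommGroup E]
    [NormedSpace ℝ E] [MeasurableSpace E] [BorelSpace E] [FiniteDimensional ℝ E] (μ : Measure E)
    [μ.IsAddHaarMeasure] {P : Set E} (hP : Convex ℝ P) (h : μ P ≠ 0) : (interior P).Nonempty := by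
  by_contra hi
  rw [Set.not_nonempty_iff_eq_empty] at hi
  refine h (measure_mono_null ?_ (hP.addHaar_frontier μ))
  rw [frontier, hi, Set.sdiff_empty]
  exact subset_closure

section

variable {E : Type*} [NormedAddCommGroup E] [NormedSpace ℝ E]
    [MeasurableSpace E] [BorelSpace E] [FiniteDimensional ℝ E] (μ : Measure E) [μ.IsAddHaarMeasure]

/-- Continuity holds because hyperplanes are null, so the pushforward under `l` has no atoms. Growth
is strict because by convexity some point of `P` lies in the open slab between the two levels, which
therefore has positive mass. -/
theorem isStrictCDF_of_convex {P : Set E} (hP : IsCompact P) (hc : Convex ℝ P)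
    (hi : (interior P).Nonempty) {l : E →L[ℝ] ℝ} (hl : l ≠ 0) :
    IsStrictCDF (μ.real P) fun c => μ.real (P ∩ {x | l x ≤ c}) := by
  have hfin : ∀ {S}, S ⊆ P → μ S ≠ ∞ := fun hS => measure_ne_top_of_subset hS hP.measure_ne_top
  have hle : ∀ c, MeasurableSet {x | l x ≤ c} := fun c =>
    measurableSet_le l.continuous.measurable measurable_const
  have hmono : Monotone fun c => μ.real (P ∩ {x | l x ≤ c}) := fun c d hcd =>
    measureReal_mono (Set.inter_subset_inter_right _ fun x hx => le_trans hx hcd)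
      (hfin Set.inter_subset_left)
  obtain ⟨x₀, hx₀⟩ := hi
  obtain ⟨a, ha⟩ := (hP.image l.continuous).bddBelow
  obtain ⟨b, hb⟩ := (hP.image l.continuous).bddAbove
  refine ⟨?_, hmono, fun _ => measureReal_nonneg, fun c => measureReal_mono Set.inter_subset_left
    (hfin subset_rfl), ⟨a - 1, ?_⟩, ⟨b, ?_⟩, ?_⟩
  · let ν : Measure ℝ := (μ.restrict P).map l
    have hfinν : IsFiniteMeasure ν := by
      have : IsFiniteMeasure (μ.restrict P) := ⟨by simpa using hP.measure_lt_top⟩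
      exact Measure.isFiniteMeasure_map _ _
    have hν : ∀ c, ν.real (Set.Iic c) = μ.real (P ∩ {x | l x ≤ c}) := by
      intro c
      rw [map_measureReal_apply l.continuous.measurable measurableSet_Iic,
        measureReal_restrict_apply (l.continuous.measurable measurableSet_Iic), Set.inter_comm]
      rfl
    have hnull : NullSingletonClass ν := ⟨fun c => by
      rw [Measure.map_apply l.continuous.measurable (measurableSet_singleton c)]
      exact Measure.restrict_le_self.absolutelyContinuous (Measure.addHaar_levelSet μ hl c)⟩
    have hcont := intervalIntegral.continuous_primitive (μ := ν) (f := fun _ => (1 : ℝ))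
      (fun a b => intervalIntegrable_const) 0
    have : (fun c => μ.real (P ∩ {x | l x ≤ c})) =
        fun c => ν.real (Set.Iic 0) + ∫ _ in (0 : ℝ)..c, (1 : ℝ) ∂ν := by
      ext c
      rw [← hν, ← intervalIntegral.integral_Iic_sub_Iic (by simp) (by simp)]
      simp [ν]
    rw [this]
    exact continuous_const.add hcont
  · have : P ∩ {x | l x ≤ a - 1} = ∅ := by
      ext x
      simp only [Set.mem_inter_iff, Set.mem_ofPred_eq, Set.mem_empty_iff_false, iff_false, not_and,
        not_le]
      intro hx
      have := ha (Set.mem_image_of_mem l hx)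
      linarith
    simp [this]
  · congr 1
    rw [Set.inter_eq_left]
    exact fun x hx => hb (Set.mem_image_of_mem l hx)
  · intro c d hcd h0 h1
    obtain ⟨x, hx, hxc⟩ : (P ∩ {x | l x ≤ c}).Nonempty := by
      by_contra h
      rw [Set.not_nonempty_iff_eq_empty] at h
      simp [h] at h0
    obtain ⟨y, hy, hyc⟩ : ∃ y ∈ P, c < l y := by
      by_contra! h
      rw [Set.inter_eq_left.2 (show P ⊆ {x | l x ≤ c} from h)] at h1
      exact lt_irrefl _ h1
    obtain ⟨z, hz, hzc, hzd⟩ : ∃ z ∈ P, c < l z ∧ l z < d := by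
      have hxc' : l x ≤ c := hxc
      have hyx : 0 < l y - l x := by linarith
      set r := (c + min d (l y)) / 2 with hr
      have hcm : c < min d (l y) := lt_min hcd hyc
      have hr1 : c < r := by rw [hr]; linarith
      have hr2 : r < min d (l y) := by rw [hr]; linarith
      set t := (r - l x) / (l y - l x) with ht
      have ht0 : 0 ≤ t := div_nonneg (by linarith) hyx.le
      have ht1 : t ≤ 1 := (div_le_one hyx).2 (by linarith [min_le_right d (l y)])
      refine ⟨(1 - t) • x + t • y, hc hx hy (by linarith) ht0 (by ring), ?_⟩
      have : l ((1 - t) • x + t • y) = r := by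
        simp only [map_add, map_smul, smul_eq_mul]
        rw [ht]
        field_simp
        ring
      rw [this]
      exact ⟨hr1, hr2.trans_le (min_le_left _ _)⟩
    have hU : IsOpen {x | c < l x ∧ l x < d} :=
      (isOpen_lt continuous_const l.continuous).inter (isOpen_lt l.continuous continuous_const)
    have hpos := hc.measure_inter_pos μ ⟨x₀, hx₀⟩ hU ⟨z, hz, hzc, hzd⟩
    have hmu := hfin (S := P ∩ {x | c < l x ∧ l x < d}) Set.inter_subset_left
    have hpos' : 0 < μ.real (P ∩ {x | c < l x ∧ l x < d}) :=
      ENNReal.toReal_pos hpos.ne' hmu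
    have hdis : Disjoint (P ∩ {x | l x ≤ c}) (P ∩ {x | c < l x ∧ l x < d}) := by
      rw [Set.disjoint_left]
      rintro w ⟨_, hw⟩ ⟨_, hw', _⟩
      exact absurd hw (not_le.2 hw')
    have hun := measureReal_union (μ := μ) hdis (hP.measurableSet.inter hU.measurableSet)
      (hfin Set.inter_subset_left) hmu
    have hsub : μ.real (P ∩ {x | l x ≤ c} ∪ P ∩ {x | c < l x ∧ l x < d}) ≤
        μ.real (P ∩ {x | l x ≤ d}) := by
      refine measureReal_mono ?_ (hfin Set.inter_subset_left)
      rintro w (⟨hw, hw'⟩ | ⟨hw, hw'⟩)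
      · exact ⟨hw, le_trans hw' hcd.le⟩
      · exact ⟨hw, hw'.2.le⟩
    linarith

theorem measureReal_inter_ge {P : Set E} (hP : IsCompact P) {l : E →L[ℝ] ℝ} (hl : l ≠ 0) (c : ℝ) :
    μ.real (P ∩ {x | c ≤ l x}) = μ.real P - μ.real (P ∩ {x | l x ≤ c}) := by
  have hfin : ∀ {S}, S ⊆ P → μ S ≠ ∞ := fun hS => measure_ne_top_of_subset hS hP.measure_ne_top
  have h := measureReal_union_add_inter (μ := μ) (s := P ∩ {x | l x ≤ c}) (t := P ∩ {x | c ≤ l x})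
    (hP.measurableSet.inter (measurableSet_le measurable_const l.continuous.measurable))
    (hfin Set.inter_subset_left) (hfin Set.inter_subset_left)
  have h1 : P ∩ {x | l x ≤ c} ∪ P ∩ {x | c ≤ l x} = P := by
    rw [← Set.inter_union_distrib_left, Set.inter_eq_left]
    exact fun x _ => le_total (l x) c
  have h2 : μ.real (P ∩ {x | l x ≤ c} ∩ (P ∩ {x | c ≤ l x})) = 0 := by
    have : μ (P ∩ {x | l x ≤ c} ∩ (P ∩ {x | c ≤ l x})) = 0 :=
      measure_mono_null (fun x hx => le_antisymm hx.1.2 hx.2.2) (Measure.addHaar_levelSet μ hl c)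
    simp [Measure.real, this]
  rw [h1, h2] at h
  linarith

end

/-- Equality case of the Brunn–Minkowski inequality for convex bodies of equal volume. -/
theorem exists_translate_of_volume_eq {m : ℕ} {P₀ P₁ Pm : Set (Fin m → ℝ)} (h₀ : IsCompact P₀)
    (h₁ : IsCompact P₁) (hm : IsCompact Pm) (c₀ : Convex ℝ P₀) (c₁ : Convex ℝ P₁)
    (hpos : 0 < volume.real P₀) (e₁ : volume.real P₁ = volume.real P₀)
    (em : volume.real Pm = volume.real P₀)
    (H : ∀ x ∈ P₀, ∀ y ∈ P₁, (1 / 2 : ℝ) • x + (1 / 2 : ℝ) • y ∈ Pm) :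
    ∃ v, P₁ = (fun x => x + v) '' P₀ := by
  have ne0 : ∀ {P : Set (Fin m → ℝ)}, 0 < volume.real P → volume P ≠ 0 := by
    intro P hP h
    simp [Measure.real, h] at hP
  have i₀ := c₀.nonempty_interior_of_measure_ne_zero volume (ne0 hpos)
  have i₁ := c₁.nonempty_interior_of_measure_ne_zero volume (ne0 (e₁ ▸ hpos))
  set A := volume.real P₀ with hA
  have bm : ∀ {S T U : Set (Fin m → ℝ)}, IsCompact S → IsCompact T → IsCompact U →
      (∀ x ∈ S, ∀ y ∈ T, (1 / 2 : ℝ) • x + (1 / 2 : ℝ) • y ∈ U) →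
      volume.real S * volume.real T ≤ volume.real U ^ 2 := by
    intro S T U hS hT hU h
    have h1 := brunn_minkowski_mul m hS hT hU (s := 1 / 2) (t := 1 / 2) (by norm_num) (by norm_num)
      (by norm_num) h
    rw [← Real.mul_rpow measureReal_nonneg measureReal_nonneg, ← Real.sqrt_eq_rpow] at h1
    exact (Real.sqrt_le_left measureReal_nonneg).1 h1
  -- Midpoints of the parts of `P₀` and `P₁` in half-spaces `l ≤ x` and `l ≤ y` lie in the part of
  -- `Pm` with `l ≤ (x + y) / 2`. Brunn–Minkowski for these and for the opposite half-spaces gives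
  -- the two hypotheses of `exists_shift`.
  have shift : ∀ {l : (Fin m → ℝ) →L[ℝ] ℝ}, l ≠ 0 → ∃ s, ∀ c,
      volume.real (P₁ ∩ {x | l x ≤ c + s}) = volume.real (P₀ ∩ {x | l x ≤ c}) := by
    intro l hl
    have f₀ := isStrictCDF_of_convex volume h₀ c₀ i₀ hl
    have f₁ := isStrictCDF_of_convex volume h₁ c₁ i₁ hl
    rw [e₁] at f₁
    have clos : ∀ c, IsClosed {x | l x ≤ c} := fun c => isClosed_le l.continuous continuous_const
    have clos' : ∀ c, IsClosed {x | c ≤ l x} := fun c => isClosed_le continuous_const l.continuous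
    refine f₀.exists_shift hpos f₁ (Fm := fun c => volume.real (Pm ∩ {x | l x ≤ c}))
      (fun _ => measureReal_nonneg)
      (fun c => (measureReal_mono Set.inter_subset_left hm.measure_ne_top).trans em.le) ?_ ?_
    · intro x y
      refine bm (h₀.inter_right (clos x)) (h₁.inter_right (clos y)) (hm.inter_right (clos _)) ?_
      rintro z ⟨hz, hz'⟩ w ⟨hw, hw'⟩
      refine ⟨H z hz w hw, ?_⟩
      simp only [Set.mem_ofPred_eq, map_add, map_smul, smul_eq_mul] at hz' hw' ⊢
      linarith
    · intro x y
      have g₀ := measureReal_inter_ge volume h₀ hl x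
      have g₁ := measureReal_inter_ge volume h₁ hl y
      have gm := measureReal_inter_ge volume hm hl ((x + y) / 2)
      rw [e₁] at g₁
      rw [em] at gm
      rw [← hA] at g₀
      rw [← g₀, ← g₁, ← gm]
      refine bm (h₀.inter_right (clos' x)) (h₁.inter_right (clos' y)) (hm.inter_right (clos' _)) ?_
      rintro z ⟨hz, hz'⟩ w ⟨hw, hw'⟩
      refine ⟨H z hz w hw, ?_⟩
      simp only [Set.mem_ofPred_eq, map_add, map_smul, smul_eq_mul] at hz' hw' ⊢
      linarith
  have int_id : ∀ {P : Set (Fin m → ℝ)}, IsCompact P → IntegrableOn (fun x => x) P :=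
    fun hP => continuous_id.continuousOn.integrableOn_compact hP
  -- The difference of the centroids is the only candidate: comparing the means of `l` on both
  -- bodies forces every shift to be `l v`.
  set v : Fin m → ℝ := A⁻¹ • ((∫ x in P₁, x) - ∫ x in P₀, x) with hv
  have shift_eq : ∀ {l : (Fin m → ℝ) →L[ℝ] ℝ} {s : ℝ}, (∀ c,
      volume.real (P₁ ∩ {x | l x ≤ c + s}) = volume.real (P₀ ∩ {x | l x ≤ c})) → s = l v := by
    intro l s hs
    have meas := l.continuous.measurable
    have fin₀ : IsFiniteMeasure (volume.restrict P₀) := ⟨by simpa using h₀.measure_lt_top⟩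
    have fin₁ : IsFiniteMeasure (volume.restrict P₁) := ⟨by simpa using h₁.measure_lt_top⟩
    have hmap : (volume.restrict P₁).map l = (volume.restrict P₀).map (fun x => l x + s) := by
      have : IsFiniteMeasure ((volume.restrict P₁).map l) := Measure.isFiniteMeasure_map _ _
      refine Measure.ext_of_Iic _ _ fun c => ?_
      rw [Measure.map_apply meas measurableSet_Iic,
        Measure.map_apply (meas.add_const s) measurableSet_Iic,
        Measure.restrict_apply (meas measurableSet_Iic),
        Measure.restrict_apply ((meas.add_const s) measurableSet_Iic), Set.inter_comm,
        Set.inter_comm _ P₀]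
      have h1 := hs (c - s)
      rw [Measure.real, Measure.real, sub_add_cancel, ENNReal.toReal_eq_toReal_iff'
        (measure_ne_top_of_subset Set.inter_subset_left h₁.measure_ne_top)
        (measure_ne_top_of_subset Set.inter_subset_left h₀.measure_ne_top)] at h1
      have hset : (fun x => l x + s) ⁻¹' Set.Iic c = {x | l x ≤ c - s} := by
        ext x
        simp [le_sub_iff_add_le]
      rw [hset]
      exact h1
    have hint : ∫ x in P₁, l x = ∫ x in P₀, (l x + s) := by
      have a1 := integral_map (μ := volume.restrict P₁) meas.aemeasurable
        (f := fun t : ℝ => t) (by fun_prop)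
      have a2 := integral_map (μ := volume.restrict P₀) (meas.add_const s).aemeasurable
        (f := fun t : ℝ => t) (by fun_prop)
      rw [← a1, ← a2, hmap]
    rw [integral_add (l.continuous.continuousOn.integrableOn_compact h₀) (by simp),
      l.integral_comp_comm (int_id h₁), l.integral_comp_comm (int_id h₀)] at hint
    simp only [integral_const, measureReal_restrict_apply_univ, smul_eq_mul, ← hA] at hint
    rw [hv, map_smul, map_sub, hint, smul_eq_mul]
    field_simp
    ring
  refine ⟨v, ?_⟩
  have cc : IsCompact ((fun x => x + v) '' P₀) := h₀.image (by fun_prop)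
  have hvol : volume ((fun x => x + v) '' P₀) = volume P₀ := by
    rw [Set.image_add_right, measure_preimage_add_right]
  have conv : Convex ℝ ((fun x => x + v) '' P₀) := by
    have := c₀.translate v
    simpa only [add_comm v] using this
  refine Convex.eq_of_subset_of_measure_le volume conv
    (conv.nonempty_interior_of_measure_ne_zero volume (by rw [hvol]; exact ne0 hpos)) h₁.isClosed ?_
    cc.measure_ne_top ?_
  · intro y hy
    by_contra hcon
    -- For the separating functional, `P₁` already has its full mass below `c`, yet near `y` it has
    -- positive mass above `c`.
    obtain ⟨l, c, h1, h2⟩ := geometric_hahn_banach_closed_point conv cc.isClosed hcon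
    have hl : l ≠ 0 := by
      rintro rfl
      obtain ⟨x, hx⟩ := i₀
      have := h1 _ (Set.mem_image_of_mem (fun x => x + v) (interior_subset hx))
      simp at this h2
      linarith
    obtain ⟨s, hs⟩ := shift hl
    have := hs (c - l v)
    rw [shift_eq hs, sub_add_cancel] at this
    have hall : P₀ ∩ {x | l x ≤ c - l v} = P₀ := by
      rw [Set.inter_eq_left]
      intro x hx
      have := h1 _ (Set.mem_image_of_mem (fun x => x + v) hx)
      simp only [map_add] at this
      simp only [Set.mem_ofPred_eq]
      linarith
    rw [hall, ← hA] at this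
    have hpos' := c₁.measure_inter_pos volume i₁ (isOpen_lt continuous_const l.continuous)
      (U := {x | c < l x}) ⟨y, hy, h2⟩
    have hge := measureReal_inter_ge volume h₁ hl c
    rw [this, e₁, sub_self] at hge
    have hz : volume (P₁ ∩ {x | c ≤ l x}) = 0 := by
      rw [Measure.real, ENNReal.toReal_eq_zero_iff] at hge
      exact hge.resolve_right (measure_ne_top_of_subset Set.inter_subset_left h₁.measure_ne_top)
    exact hpos'.ne' (measure_mono_null
      (show P₁ ∩ {x | c < l x} ⊆ P₁ ∩ {x | c ≤ l x} from fun x hx => ⟨hx.1, (show c < l x from hx.2).le⟩) hz)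
  · rw [hvol]
    exact ((ENNReal.toReal_eq_toReal_iff' h₁.measure_ne_top h₀.measure_ne_top).1 e₁).ge

/-! ### Polynomial inequalities for truncated cones. -/

section PowerInequalities

variable {x r : ℝ}

/-- After division by `1 - x ^ 2` this is AM–GM for the `k + 1` terms `x ^ (2 * i)`, `i ≤ k`, whose
geometric mean is `x ^ k`. -/
theorem mul_pow_mul_one_sub_sq_le (h0 : 0 < x) (h1 : x < 1) (k : ℕ) :
    (k + 1) * x ^ k * (1 - x ^ 2) ≤ 1 - x ^ (2 * k + 2) := by
  induction k with
  | zero => simp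
  | succ k ih =>
    have e : 2 * (1 - x ^ (2 * (k + 1) + 2)) =
        (1 - x ^ (2 * k + 2)) * (1 + x ^ 2) + (1 + (x ^ (k + 1)) ^ 2) * (1 - x ^ 2) := by ring
    have hx2 : 0 < 1 - x ^ 2 := by nlinarith
    have a1 : (k + 1) * x ^ k * (1 - x ^ 2) * (2 * x) ≤ (1 - x ^ (2 * k + 2)) * (1 + x ^ 2) :=
      mul_le_mul ih (by nlinarith [sq_nonneg (1 - x)]) (by positivity)
        ((by positivity : (0 : ℝ) ≤ (k + 1) * x ^ k * (1 - x ^ 2)).trans ih)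
    have a2 : 2 * x ^ (k + 1) * (1 - x ^ 2) ≤ (1 + (x ^ (k + 1)) ^ 2) * (1 - x ^ 2) :=
      mul_le_mul_of_nonneg_right (by nlinarith [sq_nonneg (1 - x ^ (k + 1))]) hx2.le
    have : 2 * ((↑(k + 1) + 1) * x ^ (k + 1) * (1 - x ^ 2)) =
        (k + 1) * x ^ k * (1 - x ^ 2) * (2 * x) + 2 * x ^ (k + 1) * (1 - x ^ 2) := by
      push_cast
      ring
    linarith

theorem mul_pow_mul_one_sub_sq_lt (h0 : 0 < x) (h1 : x < 1) (k : ℕ) :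
    (k + 2) * x ^ (k + 1) * (1 - x ^ 2) < 1 - x ^ (2 * k + 4) := by
  have ih := mul_pow_mul_one_sub_sq_le h0 h1 k
  have e : 2 * (1 - x ^ (2 * k + 4)) =
      (1 - x ^ (2 * k + 2)) * (1 + x ^ 2) + (1 + (x ^ (k + 1)) ^ 2) * (1 - x ^ 2) := by ring
  have hx2 : 0 < 1 - x ^ 2 := by nlinarith
  have hp : 0 < (k + 1) * x ^ k * (1 - x ^ 2) := by positivity
  have a1 : (k + 1) * x ^ k * (1 - x ^ 2) * (2 * x) < (1 - x ^ (2 * k + 2)) * (1 + x ^ 2) :=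
    mul_lt_mul' ih (by nlinarith [pow_pos (sub_pos.2 h1) 2]) (by positivity) (hp.trans_le ih)
  have a2 : 2 * x ^ (k + 1) * (1 - x ^ 2) ≤ (1 + (x ^ (k + 1)) ^ 2) * (1 - x ^ 2) :=
    mul_le_mul_of_nonneg_right (by nlinarith [sq_nonneg (1 - x ^ (k + 1))]) hx2.le
  have : 2 * ((k + 2) * x ^ (k + 1) * (1 - x ^ 2)) =
      (k + 1) * x ^ k * (1 - x ^ 2) * (2 * x) + 2 * x ^ (k + 1) * (1 - x ^ 2) := by ring
  linarith

/-- In the inductive step the new term is controlled by `1 + x ^ (2 * k + 4) - (1 + x ^ 2) * x ^ (k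
+ 1) = (1 - x ^ (k + 1)) * (1 - x ^ (k + 3))`. -/
theorem mul_pow_mul_one_sub_pow_four_le (h0 : 0 < x) (h1 : x < 1) (k : ℕ) :
    (k + 2) * x ^ k * (1 - x ^ 4) ≤ 2 * (1 - x ^ (2 * k + 4)) := by
  induction k with
  | zero => simp
  | succ k ih =>
    have e : 2 * (1 - x ^ (2 * (k + 1) + 4)) =
        (1 - x ^ (2 * k + 4)) * (1 + x ^ 2) + (1 + x ^ (2 * k + 4)) * (1 - x ^ 2) := by ring
    have hx2 : 0 < 1 - x ^ 2 := by nlinarith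
    have hx4 : 0 < 1 - x ^ 4 := by nlinarith
    have a1 : (k + 2) * x ^ k * (1 - x ^ 4) * (2 * x) ≤
        2 * (1 - x ^ (2 * k + 4)) * (1 + x ^ 2) :=
      mul_le_mul ih (by nlinarith [sq_nonneg (1 - x)]) (by positivity)
        ((by positivity : (0 : ℝ) ≤ (k + 2) * x ^ k * (1 - x ^ 4)).trans ih)
    have a3 : (1 + x ^ 2) * x ^ (k + 1) ≤ 1 + x ^ (2 * k + 4) := by
      have b1 : x ^ (k + 1) ≤ 1 := pow_le_one₀ h0.le h1.le
      have b2 : x ^ (k + 3) ≤ 1 := pow_le_one₀ h0.le h1.le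
      have : 1 + x ^ (2 * k + 4) - (1 + x ^ 2) * x ^ (k + 1) =
          (1 - x ^ (k + 1)) * (1 - x ^ (k + 3)) := by ring
      nlinarith [mul_nonneg (sub_nonneg.2 b1) (sub_nonneg.2 b2)]
    have a2 := mul_le_mul_of_nonneg_right a3 hx2.le
    have : 2 * ((↑(k + 1) + 2) * x ^ (k + 1) * (1 - x ^ 4)) =
        (k + 2) * x ^ k * (1 - x ^ 4) * (2 * x)
          + 2 * ((1 + x ^ 2) * x ^ (k + 1) * (1 - x ^ 2)) := by
      push_cast
      ring
    linarith

/-- With `N = k + 2`, division by `1 - r` turns the left side into `1 + r ^ N` plus the sum of `r ^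
i + r ^ (N - i)` over `0 < i < N`, and each such pair is less than `1 + r ^ N`. -/
theorem one_sub_pow_mul_one_add_lt (h0 : 0 < r) (h1 : r < 1) (k : ℕ) :
    (1 - r ^ (k + 2)) * (1 + r) < (k + 2) * (1 + r ^ (k + 2)) * (1 - r) := by
  have hr : 0 < 1 - r := by linarith
  have step : ∀ k : ℕ, (1 - r ^ (k + 1)) * (1 + r) ≤ (k + 1) * (1 + r ^ (k + 1)) * (1 - r) →
      (1 - r ^ (k + 2)) * (1 + r) < (k + 2) * (1 + r ^ (k + 2)) * (1 - r) := by
    intro k ih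
    have hS : 0 < 1 - r ^ (k + 1) := by
      have := pow_lt_one₀ h0.le h1 (show k + 1 ≠ 0 by omega)
      linarith
    have e : 2 * ((k + 2) * (1 + r ^ (k + 2)) * (1 - r) - (1 - r ^ (k + 2)) * (1 + r)) =
        ((k + 1) * (1 + r ^ (k + 1)) * (1 - r) - (1 - r ^ (k + 1)) * (1 + r)) * (1 + r)
          + (k + 2) * ((1 - r ^ (k + 1)) * (1 - r) ^ 2) := by ring
    have : 0 < (k + 2) * ((1 - r ^ (k + 1)) * (1 - r) ^ 2) := by positivity
    nlinarith [mul_nonneg (sub_nonneg.2 ih) (by linarith : (0 : ℝ) ≤ 1 + r)]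
  have all : ∀ k : ℕ, (1 - r ^ (k + 1)) * (1 + r) ≤ (k + 1) * (1 + r ^ (k + 1)) * (1 - r) := by
    intro k
    induction k with
    | zero => simp; nlinarith
    | succ k ih =>
      have := step k ih
      push_cast
      rw [show (k : ℝ) + 1 + 1 = k + 2 by ring]
      exact this.le
  exact step k (all k)

/-- The product of the two preceding estimates in `x`, taken at `x = √r`. -/
theorem one_sub_pow_mul_one_sub_pow_gt (h0 : 0 < r) (h1 : r < 1) (k : ℕ) :
    (k + 3) * (k + 2) * r ^ (k + 1) * (1 + r) * (1 - r) ^ 2 <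
      2 * (1 - r ^ (k + 3)) * (1 - r ^ (k + 2)) := by
  set x := Real.sqrt r with hx
  have hx2 : x ^ 2 = r := Real.sq_sqrt h0.le
  have hx0 : 0 < x := Real.sqrt_pos.2 h0
  have hx1 : x < 1 := by
    by_contra h
    nlinarith [not_lt.1 h]
  have a := mul_pow_mul_one_sub_pow_four_le hx0 hx1 (k + 1)
  have b := mul_pow_mul_one_sub_sq_lt hx0 hx1 k
  have hx4 : 0 < 1 - x ^ 4 := by
    have := pow_lt_one₀ hx0.le hx1 (show 4 ≠ 0 by norm_num)
    linarith
  have hxx : 0 < 1 - x ^ 2 := by rw [hx2]; linarith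
  have hp : (0 : ℝ) < (↑(k + 1) + 2) * x ^ (k + 1) * (1 - x ^ 4) := by positivity
  have := mul_lt_mul' a b (by positivity) (hp.trans_le a)
  rw [← hx2]
  push_cast at this
  calc _ = ((k : ℝ) + 1 + 2) * x ^ (k + 1) * (1 - x ^ 4) * ((k + 2) * x ^ (k + 1) * (1 - x ^ 2)) := by
        ring
    _ < _ := this
    _ = _ := by ring

theorem one_sub_pow_sq_gt (h0 : 0 < r) (h1 : r < 1) (k : ℕ) :
    0 < (1 - r ^ (k + 3)) ^ 2 - (k + 3) ^ 2 * r ^ (k + 2) * (1 - r) ^ 2 := by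
  set x := Real.sqrt r with hx
  have hx2 : x ^ 2 = r := Real.sq_sqrt h0.le
  have hx0 : 0 < x := Real.sqrt_pos.2 h0
  have hx1 : x < 1 := by
    by_contra h
    nlinarith [not_lt.1 h]
  have b := mul_pow_mul_one_sub_sq_lt hx0 hx1 (k + 1)
  have hxx : 0 < 1 - x ^ 2 := by rw [hx2]; linarith
  have hp : (0 : ℝ) < (↑(k + 1) + 2) * x ^ (k + 1 + 1) * (1 - x ^ 2) := by positivity
  have := mul_lt_mul'' b b hp.le hp.le
  rw [← hx2, sub_pos]
  push_cast at this
  calc _ = ((k : ℝ) + 1 + 2) * x ^ (k + 1 + 1) * (1 - x ^ 2) *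
        ((k + 1 + 2) * x ^ (k + 1 + 1) * (1 - x ^ 2)) := by ring
    _ < _ := this
    _ = _ := by ring

/-- The one-variable inequality behind the estimate for truncated cones. -/
theorem truncated_cone_inequality (h0 : 0 < r) (h1 : r < 1) (k : ℕ) :
    (1 - r ^ (2 * k + 6) - (k + 3) * r ^ (k + 2) * (1 - r ^ 2)) ^ (k + 3) <
      ((1 - r ^ (k + 3)) ^ 2 - (k + 3) ^ 2 * r ^ (k + 2) * (1 - r) ^ 2) *
        ((1 - r ^ (k + 3)) ^ 2) ^ (k + 2) := by
  -- For the truncated cone of ratio `r` in dimension `N = k + 3`, the normalised cone volumes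
  -- differ by `P₂ / ((N + 1) * Z)`, and `N` times their sum is `1 - P₁ / ((N + 1) * Z)`. The
  -- inequality for bodies thus becomes `(P₂ / Z) ^ N ≤ P₁ / Z`.
  let P₁ : ℝ → ℝ := fun r => (1 - r ^ (k + 3)) ^ 2 - (k + 3) ^ 2 * r ^ (k + 2) * (1 - r) ^ 2
  let P₂ : ℝ → ℝ := fun r => 1 - r ^ (2 * k + 6) - (k + 3) * r ^ (k + 2) * (1 - r ^ 2)
  let Z : ℝ → ℝ := fun r => (1 - r ^ (k + 3)) ^ 2
  have hP₁ : ∀ r, 0 ≤ r → r < 1 → 0 < P₁ r := by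
    intro r h0 h1
    rcases h0.eq_or_lt with rfl | h0
    · simp [P₁]
    · exact one_sub_pow_sq_gt h0 h1 k
  have hP₂ : ∀ r, 0 ≤ r → r < 1 → 0 < P₂ r := by
    intro r h0 h1
    rcases h0.eq_or_lt with rfl | h0
    · simp [P₂]
    · have := mul_pow_mul_one_sub_sq_lt h0 h1 (k + 1)
      push_cast at this
      simp only [P₂]
      rw [show (2 * k + 6) = 2 * (k + 1) + 4 by ring]
      ring_nf at this ⊢
      linarith
  have hz : ∀ r : ℝ, 0 ≤ r → r < 1 → 0 < 1 - r ^ (k + 3) := by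
    intro r h0 h1
    have := pow_lt_one₀ h0 h1 (show k + 3 ≠ 0 by omega)
    linarith
  have hZ : ∀ r, 0 ≤ r → r < 1 → 0 < Z r := fun r h0 h1 => pow_pos (hz r h0 h1) 2
  -- The logarithm of the quotient of the two sides: it vanishes at `0`, so strict decrease
  -- suffices.
  let φ : ℝ → ℝ := fun r => (k + 3) * Real.log (P₂ r) - Real.log (P₁ r) - (k + 2) * Real.log (Z r)
  have dpow : ∀ (j : ℕ) (r : ℝ), HasDerivAt (fun r : ℝ => r ^ (j + 1)) ((j + 1) * r ^ j) r := by
    intro j r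
    simpa using hasDerivAt_pow (j + 1) r
  have dP₁ : ∀ r, HasDerivAt P₁ (2 * (1 - r ^ (k + 3)) * (-((k + 3) * r ^ (k + 2))) -
      (k + 3) ^ 2 * ((k + 2) * r ^ (k + 1) * (1 - r) ^ 2 - r ^ (k + 2) * (2 * (1 - r)))) r := by
    intro r
    have a := (((dpow (k + 2) r).const_sub 1).pow 2).sub
      (((dpow (k + 1) r).const_mul ((k + 3 : ℝ) ^ 2)).mul (((hasDerivAt_id r).const_sub 1).pow 2))
    refine a.congr_deriv ?_
    simp
    ring
  have dP₂ : ∀ r, HasDerivAt P₂ (-((2 * k + 6) * r ^ (2 * k + 5)) -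
      (k + 3) * ((k + 2) * r ^ (k + 1) * (1 - r ^ 2) - r ^ (k + 2) * (2 * r))) r := by
    intro r
    have a := ((dpow (2 * k + 5) r).const_sub 1).sub
      (((dpow (k + 1) r).const_mul (k + 3 : ℝ)).mul ((dpow 1 r).const_sub 1))
    refine a.congr_deriv ?_
    simp
    ring
  have dZ : ∀ r, HasDerivAt Z (2 * (1 - r ^ (k + 3)) * (-((k + 3) * r ^ (k + 2)))) r := by
    intro r
    have a := ((dpow (k + 2) r).const_sub 1).pow 2
    refine a.congr_deriv ?_
    rw [show 2 - 1 = 1 from rfl]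
    push_cast
    ring
  have cont : ContinuousOn φ (Set.Ico 0 1) := by
    intro r hr
    have c1 := ((dP₁ r).continuousAt.log (hP₁ r hr.1 hr.2).ne')
    have c2 := ((dP₂ r).continuousAt.log (hP₂ r hr.1 hr.2).ne')
    have c3 := ((dZ r).continuousAt.log (hZ r hr.1 hr.2).ne')
    exact (((c2.const_mul _).sub c1).sub (c3.const_mul _)).continuousWithinAt
  have anti : StrictAntiOn φ (Set.Ico 0 1) := by
    refine strictAntiOn_of_deriv_neg (convex_Ico 0 1) cont fun r hr => ?_
    rw [interior_Ico] at hr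
    have q1 := hP₁ r hr.1.le hr.2
    have q2 := hP₂ r hr.1.le hr.2
    have q3 := hZ r hr.1.le hr.2
    have d := ((((dP₂ r).log q2.ne').const_mul (k + 3 : ℝ)).sub ((dP₁ r).log q1.ne')).sub
      (((dZ r).log q3.ne').const_mul (k + 2 : ℝ))
    rw [show deriv φ r = _ from d.deriv]
    have L4 := one_sub_pow_mul_one_add_lt hr.1 hr.2 (k + 1)
    have L3 := one_sub_pow_mul_one_sub_pow_gt hr.1 hr.2 k
    push_cast at L4
    -- Up to sign and a positive denominator this product is the derivative of `φ`; `L4` and `L3`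
    -- give the signs of its last two factors.
    have hpos : 0 < (k + 3 : ℝ) ^ 2 * r ^ (k + 2) * (1 - r ^ (k + 3)) *
        ((k + 3) * (1 + r ^ (k + 3)) * (1 - r) - (1 - r ^ (k + 3)) * (1 + r)) *
        (2 * (1 - r ^ (k + 3)) * (1 - r ^ (k + 2)) -
          (k + 3) * (k + 2) * r ^ (k + 1) * (1 + r) * (1 - r) ^ 2) := by
      have b1 := hz r hr.1.le hr.2
      have b2 := hr.1
      refine mul_pos (mul_pos (by positivity) (sub_pos.2 ?_)) (sub_pos.2 L3)
      rw [show k + 3 = k + 1 + 2 by ring]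
      linarith
    have hmain : (k + 3 : ℝ) * ((-((2 * k + 6) * r ^ (2 * k + 5)) -
        (k + 3) * ((k + 2) * r ^ (k + 1) * (1 - r ^ 2) - r ^ (k + 2) * (2 * r))) / P₂ r) -
        (2 * (1 - r ^ (k + 3)) * (-((k + 3) * r ^ (k + 2))) -
          (k + 3) ^ 2 * ((k + 2) * r ^ (k + 1) * (1 - r) ^ 2 - r ^ (k + 2) * (2 * (1 - r)))) / P₁ r -
        (k + 2) * (2 * (1 - r ^ (k + 3)) * (-((k + 3) * r ^ (k + 2))) / Z r) =
        -((k + 3 : ℝ) ^ 2 * r ^ (k + 2) * (1 - r ^ (k + 3)) *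
        ((k + 3) * (1 + r ^ (k + 3)) * (1 - r) - (1 - r ^ (k + 3)) * (1 + r)) *
        (2 * (1 - r ^ (k + 3)) * (1 - r ^ (k + 2)) -
          (k + 3) * (k + 2) * r ^ (k + 1) * (1 + r) * (1 - r) ^ 2)) / (P₁ r * P₂ r * Z r) := by
      rw [eq_div_iff (by positivity)]
      have n1 := q1.ne'
      have n2 := q2.ne'
      have n3 := q3.ne'
      have hR3 : r ^ (k + 3) = r ^ (k + 1) * r ^ 2 := by ring
      have hR2 : r ^ (k + 2) = r ^ (k + 1) * r := by ring
      have hR6 : r ^ (2 * k + 6) = (r ^ (k + 1)) ^ 2 * r ^ 4 := by ring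
      have hR5 : r ^ (2 * k + 5) = (r ^ (k + 1)) ^ 2 * r ^ 3 := by ring
      generalize hA : P₁ r = A at *
      generalize hB : P₂ r = B at *
      generalize hC : Z r = C at *
      have : ∀ a b c : ℝ, ((k + 3 : ℝ) * (a / B) - b / A - (k + 2) * (c / C)) * (A * B * C) =
          (k + 3) * a * A * C - b * B * C - (k + 2) * c * A * B := by
        intro a b c
        field_simp
      rw [this, ← hA, ← hB, ← hC]
      simp only [P₁, P₂, Z]
      rw [hR3, hR2, hR6, hR5]
      generalize r ^ (k + 1) = R
      generalize (k : ℝ) = κ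
      ring
    rw [hmain]
    exact div_neg_of_neg_of_pos (neg_lt_zero.2 hpos) (by positivity)
  have hlt := anti (Set.left_mem_Ico.2 one_pos) ⟨h0.le, h1⟩ h0
  have hφ0 : φ 0 = 0 := by simp [φ, P₁, P₂, Z]
  rw [hφ0] at hlt
  have q1 := hP₁ r h0.le h1
  have q2 := hP₂ r h0.le h1
  have q3 := hZ r h0.le h1
  change P₂ r ^ (k + 3) < P₁ r * Z r ^ (k + 2)
  rw [← Real.log_lt_log_iff (by positivity) (by positivity), Real.log_mul q1.ne' (by positivity),
    Real.log_pow, Real.log_pow]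
  simp only [φ] at hlt
  push_cast
  linarith

end PowerInequalities

/-! ### Monotonicity in the two cone volumes. -/

/-- The left-hand side of the inequality between the cone volumes `x` and `y` of two opposite
facets of a body of volume `1`. -/
noncomputable def oppositeConeSum (n : ℕ) (x y : ℝ) : ℝ :=
  n * (x + y) + ((n : ℝ) + 1) ^ (n - 1) * |x - y| ^ n

theorem oppositeConeSum_comm (n : ℕ) (x y : ℝ) : oppositeConeSum n x y = oppositeConeSum n y x := by
  rw [oppositeConeSum, oppositeConeSum, add_comm x, abs_sub_comm]

section Monotone

variable {n : ℕ} {x y X Y : ℝ}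

theorem succ_mul_pow_pred (hn : n ≠ 0) (d : ℝ) :
    ((n : ℝ) + 1) * (((n : ℝ) + 1) ^ (n - 1) * d ^ n) = (((n : ℝ) + 1) * d) ^ n := by
  obtain ⟨k, rfl⟩ := Nat.exists_eq_succ_of_ne_zero hn
  generalize ((k.succ : ℕ) : ℝ) + 1 = c
  rw [Nat.succ_sub_one, mul_pow, Nat.succ_eq_add_one]
  ring

/-- Bernoulli's inequality replaces the power by its tangent at `1`, which gives `(n + 1) * (X + Y +
|X - Y|) ≤ 2`; the bracket is at least `2 * X`. -/
theorem le_of_oppositeConeSum_le_one (hn : n ≠ 0) (h : oppositeConeSum n X Y ≤ 1) :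
    ((n : ℝ) + 1) * X ≤ 1 := by
  have hn' : (0 : ℝ) < n := by positivity
  have b := one_add_mul_le_pow (a := ((n : ℝ) + 1) * |X - Y| - 1)
    (by nlinarith [abs_nonneg (X - Y)]) n
  rw [add_sub_cancel, ← succ_mul_pow_pred hn] at b
  rw [oppositeConeSum] at h
  have d := le_abs_self (X - Y)
  have h' := mul_le_mul_of_nonneg_left h (by positivity : (0 : ℝ) ≤ n + 1)
  rw [mul_add] at h'
  have h2 : (n : ℝ) * ((n + 1) * (X + Y + |X - Y|)) ≤ n * 2 := by linarith
  have h3 := le_of_mul_le_mul_left h2 hn'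
  have h4 := mul_le_mul_of_nonneg_left d (by positivity : (0 : ℝ) ≤ n + 1)
  linarith

theorem pow_sub_pow_lt {e f : ℝ} (he : 0 ≤ e) (hef : e < f) (hf : f ≤ 1) (k : ℕ) :
    f ^ (k + 2) - e ^ (k + 2) < (k + 2) * (f - e) := by
  induction k with
  | zero =>
    have : 0 < (f - e) * (2 - f - e) := mul_pos (by linarith) (by linarith)
    push_cast
    nlinarith
  | succ k ih =>
    have a1 : e ^ (k + 2) ≤ 1 := pow_le_one₀ he (by linarith)
    have a2 : e ^ (k + 2) ≤ f ^ (k + 2) := pow_le_pow_left₀ he hef.le _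
    have : f ^ (k + 1 + 2) - e ^ (k + 1 + 2) =
        f * (f ^ (k + 2) - e ^ (k + 2)) + e ^ (k + 2) * (f - e) := by ring
    push_cast
    nlinarith

/-- Only the case where `|x - y|` exceeds `|X - Y|` is in doubt. There `(n + 1) * |x - y| ≤ 1`, so
the power term has slope at most `n` in the difference, while the linear term loses `n` per unit of
decrease of `x + y`. The increase of the difference is at most the decrease of the sum. -/
theorem oppositeConeSum_mono (hn : 2 ≤ n) (hx : 0 ≤ x) (hy : 0 ≤ y) (hxX : x ≤ X) (hyY : y ≤ Y)
    (h : oppositeConeSum n X Y ≤ 1) : oppositeConeSum n x y ≤ oppositeConeSum n X Y ∧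
      (oppositeConeSum n x y = oppositeConeSum n X Y → x = X ∧ y = Y) := by
  have hn0 : n ≠ 0 := by omega
  have hn' : (0 : ℝ) < n := by positivity
  have bX := le_of_oppositeConeSum_le_one hn0 h
  have bY := le_of_oppositeConeSum_le_one hn0 (by rwa [oppositeConeSum_comm] at h)
  have hd : ((n : ℝ) + 1) * |x - y| ≤ 1 := by
    rcases abs_cases (x - y) with ⟨e, _⟩ | ⟨e, _⟩ <;> rw [e] <;> nlinarith
  have e1 := succ_mul_pow_pred hn0 |x - y|
  have e2 := succ_mul_pow_pred hn0 |X - Y|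
  rcases le_or_gt |x - y| |X - Y| with hle | hlt
  · have hp : ((n : ℝ) + 1) ^ (n - 1) * |x - y| ^ n ≤ ((n : ℝ) + 1) ^ (n - 1) * |X - Y| ^ n := by
      gcongr
    rw [oppositeConeSum, oppositeConeSum]
    refine ⟨by nlinarith, fun heq => ?_⟩
    have : (n : ℝ) * (X + Y) ≤ n * (x + y) := by linarith
    have := le_of_mul_le_mul_left this hn'
    constructor <;> linarith
  · obtain ⟨k, rfl⟩ := Nat.exists_eq_add_of_le' hn
    have hs := pow_sub_pow_lt (e := (((k + 2 : ℕ) : ℝ) + 1) * |X - Y|)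
      (f := (((k + 2 : ℕ) : ℝ) + 1) * |x - y|) (by positivity)
      (mul_lt_mul_of_pos_left hlt (by positivity)) hd k
    rw [← e1, ← e2] at hs
    have tri : |x - y| - |X - Y| ≤ (X - x) + (Y - y) := by
      refine (abs_sub_abs_le_abs_sub _ _).trans ?_
      rw [abs_le]
      constructor <;> linarith
    have key : ((k + 2 : ℕ) : ℝ) * (x + y) + (((k + 2 : ℕ) : ℝ) + 1) ^ (k + 2 - 1) * |x - y| ^ (k + 2) <
        ((k + 2 : ℕ) : ℝ) * (X + Y) + (((k + 2 : ℕ) : ℝ) + 1) ^ (k + 2 - 1) * |X - Y| ^ (k + 2) := by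
      set a := (((k + 2 : ℕ) : ℝ) + 1) ^ (k + 2 - 1) * |x - y| ^ (k + 2)
      set b := (((k + 2 : ℕ) : ℝ) + 1) ^ (k + 2 - 1) * |X - Y| ^ (k + 2)
      have hc : (0 : ℝ) < ((k + 2 : ℕ) : ℝ) + 1 := by positivity
      have hs' : (((k + 2 : ℕ) : ℝ) + 1) * (a - b) <
          (((k + 2 : ℕ) : ℝ) + 1) * (((k + 2 : ℕ) : ℝ) * (|x - y| - |X - Y|)) := by
        push_cast at hs ⊢
        nlinarith
      have hs'' := lt_of_mul_lt_mul_left hs' hc.le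
      nlinarith
    exact ⟨key.le, fun heq => absurd heq key.ne⟩

end Monotone

/-! ### Affine profiles: truncated cones. -/

section Linear

variable {m : ℕ} {r : ℝ}

theorem integral_linear_pow (hr : r ≠ 1) (m : ℕ) :
    ∫ s in (0 : ℝ)..1, (r + (1 - r) * s) ^ m = (1 - r ^ (m + 1)) / ((m + 1) * (1 - r)) := by
  have h1 : 1 - r ≠ 0 := sub_ne_zero.2 hr.symm
  have hm : (m : ℝ) + 1 ≠ 0 := by positivity
  have d : ∀ s : ℝ, HasDerivAt (fun s : ℝ => (r + (1 - r) * s) ^ (m + 1) / ((m + 1) * (1 - r)))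
      ((r + (1 - r) * s) ^ m) s := by
    intro s
    have := (((((hasDerivAt_id s).const_mul (1 - r)).const_add r).pow (m + 1))).div_const
      ((m + 1) * (1 - r))
    refine this.congr_deriv ?_
    simp
    field_simp
  rw [intervalIntegral.integral_eq_sub_of_hasDerivAt (fun s _ => d s)
    (Continuous.intervalIntegrable (by fun_prop) _ _)]
  simp
  field_simp

theorem integral_id_mul_linear_pow (hr : r ≠ 1) (m : ℕ) :
    ∫ s in (0 : ℝ)..1, s * (r + (1 - r) * s) ^ m =
      ((1 - r ^ (m + 2)) / (m + 2) - r * (1 - r ^ (m + 1)) / (m + 1)) / (1 - r) ^ 2 := by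
  have h1 : 1 - r ≠ 0 := sub_ne_zero.2 hr.symm
  have e : ∀ s : ℝ, s * (r + (1 - r) * s) ^ m =
      ((r + (1 - r) * s) ^ (m + 1) - r * (r + (1 - r) * s) ^ m) / (1 - r) := by
    intro s
    field_simp
    ring
  simp only [e]
  rw [intervalIntegral.integral_div, intervalIntegral.integral_sub
    (Continuous.intervalIntegrable (by fun_prop) _ _)
    (Continuous.intervalIntegrable (by fun_prop) _ _), intervalIntegral.integral_const_mul,
    integral_linear_pow hr, integral_linear_pow hr]
  push_cast
  have hm : (m : ℝ) + 1 ≠ 0 := by positivity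
  have hm' : (m : ℝ) + 2 ≠ 0 := by positivity
  have hm'' : (m : ℝ) + 1 + 1 ≠ 0 := by positivity
  field_simp
  ring

theorem integral_linear_pow_pos (h0 : 0 ≤ r) (m : ℕ) :
    0 < ∫ s in (0 : ℝ)..1, (r + (1 - r) * s) ^ m := by
  refine intervalIntegral.intervalIntegral_pos_of_pos_on
    (Continuous.intervalIntegrable (by fun_prop) _ _) (fun s hs => pow_pos ?_ m) one_pos
  nlinarith [hs.1, hs.2]

/-- The inequality for truncated cones. -/
theorem oppositeConeSum_linear (hm : 2 ≤ m) (h0 : 0 ≤ r) (h1 : r ≤ 1) {V W : ℝ}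
    (hV : V = ∫ s in (0 : ℝ)..1, (r + (1 - r) * s) ^ m)
    (hW : W = ∫ s in (0 : ℝ)..1, s * (r + (1 - r) * s) ^ m) :
    oppositeConeSum (m + 1) ((V - W) / ((m + 1) * V ^ 2)) (W * r ^ m / ((m + 1) * V ^ 2)) ≤ 1 ∧
      (oppositeConeSum (m + 1) ((V - W) / ((m + 1) * V ^ 2)) (W * r ^ m / ((m + 1) * V ^ 2)) = 1 →
        r = 0 ∨ r = 1) := by
  -- The closed forms of the integrals divide by `1 - r`, so the prism is treated apart; it gives
  -- equality.
  rcases h1.eq_or_lt with rfl | h1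
  · refine ⟨?_, fun _ => Or.inr rfl⟩
    have hV1 : V = 1 := by rw [hV]; simp
    have hW1 : W = 1 / 2 := by rw [hW]; simp
    rw [hV1, hW1, oppositeConeSum]
    have hm' : (m : ℝ) + 1 ≠ 0 := by positivity
    have : (1 - 1 / 2) / (((m : ℝ) + 1) * 1 ^ 2) - 1 / 2 * 1 ^ m / ((m + 1) * 1 ^ 2) = 0 := by
      rw [one_pow]; ring
    rw [this]
    simp
    field_simp
    norm_num
  rw [integral_linear_pow h1.ne] at hV
  rw [integral_id_mul_linear_pow h1.ne] at hW
  have hr : 0 < 1 - r := by linarith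
  obtain ⟨k, rfl⟩ := Nat.exists_eq_add_of_le' hm
  have hz : 0 < 1 - r ^ (k + 3) := by
    have := pow_lt_one₀ h0 h1 (show k + 3 ≠ 0 by omega)
    linarith
  have hz' := hz.ne'
  have hr' := hr.ne'
  have hk3 : (k : ℝ) + 3 ≠ 0 := by positivity
  have hk4 : (k : ℝ) + 4 ≠ 0 := by positivity
  have hX : (V - W) / ((((k + 2 : ℕ) : ℝ) + 1) * V ^ 2) =
      (1 - (k + 4) * r ^ (k + 3) + (k + 3) * r ^ (k + 4)) / ((k + 4) * (1 - r ^ (k + 3)) ^ 2) := by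
    rw [hV, hW]
    push_cast
    rw [show k + 2 + 1 = k + 3 by ring, show k + 2 + 2 = k + 4 by ring,
      show (k : ℝ) + 2 + 1 = k + 3 by ring, show (k : ℝ) + 2 + 2 = k + 4 by ring]
    field_simp
    ring
  have hY : W * r ^ (k + 2) / ((((k + 2 : ℕ) : ℝ) + 1) * V ^ 2) =
      r ^ (k + 2) * (k + 3 - (k + 4) * r + r ^ (k + 4)) / ((k + 4) * (1 - r ^ (k + 3)) ^ 2) := by
    rw [hV, hW]
    push_cast
    rw [show k + 2 + 1 = k + 3 by ring, show k + 2 + 2 = k + 4 by ring,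
      show (k : ℝ) + 2 + 1 = k + 3 by ring, show (k : ℝ) + 2 + 2 = k + 4 by ring]
    field_simp
    ring
  rw [hX, hY]
  rcases h0.eq_or_lt with rfl | h0
  · refine ⟨le_of_eq ?_, fun _ => Or.inl rfl⟩
    rw [oppositeConeSum]
    simp
    rw [abs_of_pos (by positivity), show (k : ℝ) + 2 + 1 + 1 = k + 4 by ring,
      show (k : ℝ) + 2 + 1 = k + 3 by ring, pow_succ _ (k + 2)]
    field_simp
    ring
  set P₁ := (1 - r ^ (k + 3)) ^ 2 - (k + 3) ^ 2 * r ^ (k + 2) * (1 - r) ^ 2 with hP₁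
  set P₂ := 1 - r ^ (2 * k + 6) - (k + 3) * r ^ (k + 2) * (1 - r ^ 2) with hP₂
  have hP₂0 : 0 < P₂ := by
    have := mul_pow_mul_one_sub_sq_lt h0 h1 (k + 1)
    push_cast at this
    rw [hP₂, show (2 * k + 6) = 2 * (k + 1) + 4 by ring]
    ring_nf at this ⊢
    linarith
  have main := truncated_cone_inequality h0 h1 k
  rw [← hP₁, ← hP₂] at main
  set Z := (1 - r ^ (k + 3)) ^ 2 with hZ
  have hZ0 : 0 < Z := by positivity
  have hsub : (1 - (k + 4) * r ^ (k + 3) + (k + 3) * r ^ (k + 4)) / ((k + 4) * Z) -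
      r ^ (k + 2) * (k + 3 - (k + 4) * r + r ^ (k + 4)) / ((k + 4) * Z) = P₂ / Z / (k + 4) := by
    rw [← sub_div, div_div, mul_comm Z]
    congr 1
    rw [hP₂]
    ring
  have hadd : (k + 3) * ((1 - (k + 4) * r ^ (k + 3) + (k + 3) * r ^ (k + 4)) / ((k + 4) * Z) +
      r ^ (k + 2) * (k + 3 - (k + 4) * r + r ^ (k + 4)) / ((k + 4) * Z)) =
        1 - P₁ / Z / (k + 4) := by
    rw [← add_div]
    field_simp
    rw [hP₁, hZ]
    ring
  have hlt : oppositeConeSum (k + 2 + 1)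
      ((1 - (k + 4) * r ^ (k + 3) + (k + 3) * r ^ (k + 4)) / ((k + 4) * Z))
      (r ^ (k + 2) * (k + 3 - (k + 4) * r + r ^ (k + 4)) / ((k + 4) * Z)) < 1 := by
    rw [oppositeConeSum, hsub, abs_of_pos (by positivity)]
    push_cast
    rw [show (k : ℝ) + 2 + 1 = k + 3 by ring, hadd]
    have hq : (P₂ / Z) ^ (k + 3) < P₁ / Z := by
      rw [div_pow, div_lt_div_iff₀ (by positivity) hZ0]
      calc P₂ ^ (k + 3) * Z < P₁ * Z ^ (k + 2) * Z := mul_lt_mul_of_pos_right main hZ0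
        _ = P₁ * Z ^ (k + 3) := by ring
    have he : ((k : ℝ) + 3 + 1) ^ (k + 2) * (P₂ / Z / (k + 4)) ^ (k + 2 + 1) =
        (P₂ / Z) ^ (k + 3) / (k + 4) := by
      rw [show (k : ℝ) + 3 + 1 = k + 4 by ring, div_pow _ ((k : ℝ) + 4)]
      field_simp
      ring
    rw [he]
    have := div_lt_div_of_pos_right hq (by positivity : (0 : ℝ) < k + 4)
    linarith
  exact ⟨hlt.le, fun h => absurd h hlt.ne⟩

end Linear

/-! ### Comparing profiles of equal mass. -/

section Comparison

variable {m : ℕ} {g k : ℝ → ℝ}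

/-- If `g - k` is concave and nonnegative at `0`, then among densities of equal mass `g ^ m` has
the smaller first moment. -/
theorem integral_id_mul_pow_le (hm : m ≠ 0)
    (hc : ConcaveOn ℝ (Set.Icc 0 1) fun s => g s - k s) (hg : ∀ s ∈ Set.Icc (0 : ℝ) 1, 0 ≤ g s)
    (hk : ∀ s ∈ Set.Icc (0 : ℝ) 1, 0 ≤ k s)
    (hgi : IntervalIntegrable (fun s => g s ^ m) volume 0 1)
    (hki : IntervalIntegrable (fun s => k s ^ m) volume 0 1)
    (hV : ∫ s in (0 : ℝ)..1, g s ^ m = ∫ s in (0 : ℝ)..1, k s ^ m) (h0 : k 0 ≤ g 0) :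
    ∫ s in (0 : ℝ)..1, s * g s ^ m ≤ ∫ s in (0 : ℝ)..1, s * k s ^ m ∧
      (k 0 < g 0 → ∫ s in (0 : ℝ)..1, s * g s ^ m < ∫ s in (0 : ℝ)..1, s * k s ^ m) := by
  have mem0 : (0 : ℝ) ∈ Set.Icc (0 : ℝ) 1 := by simp
  have mem1 : (1 : ℝ) ∈ Set.Icc (0 : ℝ) 1 := by simp
  -- By concavity `g - k` is nonnegative before `τ = sSup S`; after `τ` it is nonpositive. So there
  -- is one sign change, and `(τ - s) * (g s ^ m - k s ^ m)` is never negative.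
  set S := {s ∈ Set.Icc (0 : ℝ) 1 | k s ≤ g s} with hS
  have hSb : BddAbove S := ⟨1, fun s hs => hs.1.2⟩
  have hS0 : (0 : ℝ) ∈ S := ⟨mem0, h0⟩
  set τ := sSup S with hτ
  have low : ∀ s ∈ Set.Icc (0 : ℝ) 1, s < τ → k s ≤ g s := by
    intro s hs hsτ
    obtain ⟨s', hs', hlt⟩ := exists_lt_of_lt_csSup ⟨0, hS0⟩ hsτ
    have hs'0 : 0 < s' := hs.1.trans_lt hlt
    have := hc.2 mem0 hs'.1 (show 0 ≤ 1 - s / s' by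
      rw [sub_nonneg, div_le_one hs'0]; exact hlt.le) (show 0 ≤ s / s' from div_nonneg hs.1 hs'0.le)
      (by ring)
    simp only [smul_eq_mul, mul_zero, zero_add, div_mul_cancel₀ _ hs'0.ne'] at this
    have a1 : 0 ≤ (1 - s / s') * (g 0 - k 0) := mul_nonneg (by
      rw [sub_nonneg, div_le_one hs'0]; exact hlt.le) (sub_nonneg.2 h0)
    have a2 : 0 ≤ s / s' * (g s' - k s') :=
      mul_nonneg (div_nonneg hs.1 hs'0.le) (sub_nonneg.2 hs'.2)
    linarith
  have high : ∀ s ∈ Set.Icc (0 : ℝ) 1, τ < s → g s ≤ k s := by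
    intro s hs hsτ
    by_contra h
    exact (le_csSup hSb ⟨hs, (not_le.1 h).le⟩).not_gt hsτ
  have sign : ∀ s ∈ Set.Icc (0 : ℝ) 1, 0 ≤ (τ - s) * (g s ^ m - k s ^ m) := by
    intro s hs
    rcases lt_trichotomy s τ with h | h | h
    · exact mul_nonneg (by linarith)
        (sub_nonneg.2 (pow_le_pow_left₀ (hk s hs) (low s hs h) m))
    · simp [h]
    · exact mul_nonneg_of_nonpos_of_nonpos (by linarith)
        (sub_nonpos.2 (pow_le_pow_left₀ (hg s hs) (high s hs h) m))
  have hgi' : IntervalIntegrable (fun s => s * g s ^ m) volume 0 1 :=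
    hgi.continuousOn_mul continuousOn_id
  have hki' : IntervalIntegrable (fun s => s * k s ^ m) volume 0 1 :=
    hki.continuousOn_mul continuousOn_id
  have hFi : IntervalIntegrable (fun s => (τ - s) * (g s ^ m - k s ^ m)) volume 0 1 :=
    (hgi.sub hki).continuousOn_mul (by fun_prop)
  -- Equality of the masses removes the term with `τ`, leaving the difference of the first moments.
  have expand : ∫ s in (0 : ℝ)..1, (τ - s) * (g s ^ m - k s ^ m) =
      (∫ s in (0 : ℝ)..1, s * k s ^ m) - ∫ s in (0 : ℝ)..1, s * g s ^ m := by
    have e : (fun s => (τ - s) * (g s ^ m - k s ^ m)) = fun s =>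
        τ * (g s ^ m - k s ^ m) - (s * g s ^ m - s * k s ^ m) := by
      ext s; ring
    rw [e, intervalIntegral.integral_sub ((hgi.sub hki).const_mul τ) (hgi'.sub hki'),
      intervalIntegral.integral_const_mul, intervalIntegral.integral_sub hgi hki, hV,
      intervalIntegral.integral_sub hgi' hki']
    ring
  refine ⟨?_, fun hlt => ?_⟩
  · have := intervalIntegral.integral_nonneg (μ := volume) zero_le_one sign
    linarith
  -- The chord of `g - k` over `[0, 1]` is positive on `[0, d / (d + |b|))`, and a concave function
  -- lies above its chord.
  · obtain ⟨ε, hε0, hε1, hε⟩ : ∃ ε : ℝ, 0 < ε ∧ ε ≤ 1 ∧ ∀ s, 0 ≤ s → s < ε → k s < g s := by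
      set d := g 0 - k 0 with hd
      set b := g 1 - k 1 with hb
      have hd0 : 0 < d := sub_pos.2 hlt
      refine ⟨d / (d + |b|), by positivity, ?_, fun s hs hs' => ?_⟩
      · rw [div_le_one (by positivity)]
        linarith [abs_nonneg b]
      · have hs1 : s ≤ 1 := hs'.le.trans (by
          rw [div_le_one (by positivity)]; linarith [abs_nonneg b])
        have := hc.2 mem0 mem1 (sub_nonneg.2 hs1) hs (by ring)
        simp only [smul_eq_mul, mul_zero, zero_add, mul_one] at this
        rw [lt_div_iff₀ (by positivity)] at hs'
        have hbb := mul_le_mul_of_nonneg_left (neg_abs_le b) hs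
        rw [← hd, ← hb] at this
        nlinarith
    have hτε : ε ≤ τ := by
      by_contra h
      push Not at h
      have hτ0 : 0 ≤ τ := le_csSup hSb hS0
      have h1 : (τ + ε) / 2 ∈ S :=
        ⟨⟨by linarith, by linarith⟩, (hε _ (by linarith) (by linarith)).le⟩
      have := le_csSup hSb h1
      linarith
    have i1 : IntervalIntegrable (fun s => (τ - s) * (g s ^ m - k s ^ m)) volume 0 ε :=
      hFi.mono_set (by
        rw [Set.uIcc_of_le hε0.le, Set.uIcc_of_le zero_le_one]
        exact Set.Icc_subset_Icc_right hε1)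
    have i2 : IntervalIntegrable (fun s => (τ - s) * (g s ^ m - k s ^ m)) volume ε 1 :=
      hFi.mono_set (by
        rw [Set.uIcc_of_le hε1, Set.uIcc_of_le zero_le_one]
        exact Set.Icc_subset_Icc_left hε0.le)
    have p1 : 0 < ∫ s in (0 : ℝ)..ε, (τ - s) * (g s ^ m - k s ^ m) := by
      refine intervalIntegral.intervalIntegral_pos_of_pos_on i1 (fun s hs => ?_) hε0
      exact mul_pos (by linarith [hs.2]) (sub_pos.2 (pow_lt_pow_left₀ (hε s hs.1.le hs.2)
        (hk s ⟨hs.1.le, hs.2.le.trans hε1⟩) hm))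
    have p2 : 0 ≤ ∫ s in ε..(1 : ℝ), (τ - s) * (g s ^ m - k s ^ m) :=
      intervalIntegral.integral_nonneg hε1 fun s hs => sign s ⟨hε0.le.trans hs.1, hs.2⟩
    have := intervalIntegral.integral_add_adjacent_intervals i1 i2
    linarith

theorem ConcaveOn.comp_one_sub {f : ℝ → ℝ} (hf : ConcaveOn ℝ (Set.Icc 0 1) f) :
    ConcaveOn ℝ (Set.Icc 0 1) fun s => f (1 - s) := by
  refine ⟨convex_Icc 0 1, fun x hx y hy a b ha hb hab => ?_⟩
  have := hf.2 (x := 1 - x) (y := 1 - y) ⟨by linarith [hx.2], by linarith [hx.1]⟩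
    ⟨by linarith [hy.2], by linarith [hy.1]⟩ ha hb hab
  simp only [smul_eq_mul] at this ⊢
  rwa [show a * (1 - x) + b * (1 - y) = 1 - (a * x + b * y) by linear_combination hab] at this

theorem IntervalIntegrable.comp_one_sub {f : ℝ → ℝ} (hf : IntervalIntegrable f volume 0 1) :
    IntervalIntegrable (fun s => f (1 - s)) volume 0 1 := by
  have := (hf.comp_sub_left 1).symm
  simpa using this

theorem integral_comp_one_sub (f : ℝ → ℝ) :
    ∫ s in (0 : ℝ)..1, f (1 - s) = ∫ s in (0 : ℝ)..1, f s := by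
  simp

theorem integral_id_mul_comp_one_sub {f : ℝ → ℝ} (hf : IntervalIntegrable f volume 0 1) :
    ∫ s in (0 : ℝ)..1, s * f (1 - s) =
      (∫ s in (0 : ℝ)..1, f s) - ∫ s in (0 : ℝ)..1, s * f s := by
  have h := integral_comp_one_sub fun s => (1 - s) * f s
  simp only [sub_sub_cancel] at h
  rw [h, ← intervalIntegral.integral_sub hf (hf.continuousOn_mul (g := fun s => s)
    continuousOn_id)]
  congr 1
  ext s
  ring

/-- A concave density with prescribed mass and first moment lies below the truncated cone with
the same mass and moment at both ends. -/
theorem endpoint_le_of_moments_eq (hm : m ≠ 0)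
    (hc : ConcaveOn ℝ (Set.Icc 0 1) fun s => g s - k s) (hg : ∀ s ∈ Set.Icc (0 : ℝ) 1, 0 ≤ g s)
    (hk : ∀ s ∈ Set.Icc (0 : ℝ) 1, 0 ≤ k s)
    (hgi : IntervalIntegrable (fun s => g s ^ m) volume 0 1)
    (hki : IntervalIntegrable (fun s => k s ^ m) volume 0 1)
    (hV : ∫ s in (0 : ℝ)..1, g s ^ m = ∫ s in (0 : ℝ)..1, k s ^ m)
    (hW : ∫ s in (0 : ℝ)..1, s * g s ^ m = ∫ s in (0 : ℝ)..1, s * k s ^ m) :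
    g 0 ≤ k 0 ∧ g 1 ≤ k 1 := by
  have refl : ∀ s ∈ Set.Icc (0 : ℝ) 1, 1 - s ∈ Set.Icc (0 : ℝ) 1 := fun s hs =>
    ⟨by linarith [hs.2], by linarith [hs.1]⟩
  constructor
  · by_contra h
    push Not at h
    exact ((integral_id_mul_pow_le hm hc hg hk hgi hki hV h.le).2 h).ne hW
  · by_contra h
    push Not at h
    refine ((integral_id_mul_pow_le (g := fun s => g (1 - s)) (k := fun s => k (1 - s)) hm
      hc.comp_one_sub (fun s hs => hg _ (refl s hs)) (fun s hs => hk _ (refl s hs))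
      hgi.comp_one_sub hki.comp_one_sub ?_ ?_).2 ?_).ne ?_
    · rw [integral_comp_one_sub fun s => g s ^ m, integral_comp_one_sub fun s => k s ^ m, hV]
    · simpa using h.le
    · simpa using h
    · rw [integral_id_mul_comp_one_sub hgi, integral_id_mul_comp_one_sub hki, hV, hW]

end Comparison

/-! ### Concave profiles. -/

/-- The inequality for a concave profile whose centroid lies in the upper half. -/
theorem oppositeConeSum_concave_aux {m : ℕ} (hm : 2 ≤ m) {g : ℝ → ℝ}
    (hc : ConcaveOn ℝ (Set.Icc 0 1) g) (hg : ∀ s ∈ Set.Icc (0 : ℝ) 1, 0 ≤ g s)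
    (hgi : IntervalIntegrable (fun s => g s ^ m) volume 0 1) {V W : ℝ}
    (hV : V = ∫ s in (0 : ℝ)..1, g s ^ m) (hW : W = ∫ s in (0 : ℝ)..1, s * g s ^ m) (hV0 : 0 < V)
    (hVW : V / 2 ≤ W) :
    oppositeConeSum (m + 1) ((V - W) * g 1 ^ m / ((m + 1) * V ^ 2))
        (W * g 0 ^ m / ((m + 1) * V ^ 2)) ≤ 1 ∧
      (oppositeConeSum (m + 1) ((V - W) * g 1 ^ m / ((m + 1) * V ^ 2))
        (W * g 0 ^ m / ((m + 1) * V ^ 2)) = 1 →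
        (g 0 = g 1 ∧ g (1 / 2) = g 1 ∧ V = g 1 ^ m) ∨ (g 0 = 0 ∧ V = g 1 ^ m / (m + 1))) := by
  have hm0 : m ≠ 0 := by omega
  have hm1 : (0 : ℝ) < m + 1 := by positivity
  have mem0 : (0 : ℝ) ∈ Set.Icc (0 : ℝ) 1 := by simp
  have mem1 : (1 : ℝ) ∈ Set.Icc (0 : ℝ) 1 := by simp
  have root : ∀ {v : ℝ}, 0 < v → ∃ κ, 0 < κ ∧ κ ^ m = v := fun {v} hv =>
    ⟨v ^ (m⁻¹ : ℝ), by positivity, Real.rpow_inv_natCast_pow hv.le hm0⟩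
  have hW0 : 0 < W := by linarith
  -- Comparison with the cone `κ * s` of the same mass, whose centroid is at `(m + 1) / (m + 2)`.
  have hWle : W ≤ (m + 1) / (m + 2) * V := by
    obtain ⟨κ, hκ0, hκ⟩ := root (mul_pos hm1 hV0)
    have kc : ConcaveOn ℝ (Set.Icc 0 1) fun s => g s - κ * s :=
      hc.sub ((convexOn_id (convex_Icc 0 1)).smul hκ0.le)
    have i1 := integral_linear_pow (r := 0) zero_ne_one m
    have i2 := integral_id_mul_linear_pow (r := 0) zero_ne_one m
    simp only [zero_add, sub_zero, one_mul, mul_one, zero_mul, zero_div, one_pow, div_one] at i1 i2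
    rw [zero_pow (by omega), sub_zero] at i1 i2
    have := (integral_id_mul_pow_le hm0 kc hg (fun s hs => mul_nonneg hκ0.le hs.1) hgi
      (Continuous.intervalIntegrable (by fun_prop) _ _) (by
        simp only [mul_pow]
        rw [← hV, intervalIntegral.integral_const_mul, i1, hκ]
        field_simp) (by simpa using hg 0 mem0)).1
    simp only [mul_pow, mul_left_comm _ (κ ^ m)] at this
    rw [← hW, intervalIntegral.integral_const_mul, i2, hκ] at this
    refine this.trans (le_of_eq ?_)
    ring
  -- The centroid of the truncated cone moves continuously from `1 / 2` at `r = 1` to `(m + 1) / (m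
  -- + 2)` at `r = 0`; `hVW` and `hWle` place `W / V` in between.
  obtain ⟨r, ⟨hr0, hr1⟩, hr⟩ : ∃ r ∈ Set.Icc (0 : ℝ) 1,
      (∫ s in (0 : ℝ)..1, s * (r + (1 - r) * s) ^ m) /
        (∫ s in (0 : ℝ)..1, (r + (1 - r) * s) ^ m) = W / V := by
    have cont : ContinuousOn (fun r : ℝ => (∫ s in (0 : ℝ)..1, s * (r + (1 - r) * s) ^ m) /
        (∫ s in (0 : ℝ)..1, (r + (1 - r) * s) ^ m)) (Set.Icc 0 1) := by
      refine ContinuousOn.div ?_ ?_ fun r hr => (integral_linear_pow_pos hr.1 m).ne'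
      · exact (intervalIntegral.continuous_parametric_intervalIntegral_of_continuous'
          (f := fun r s : ℝ => s * (r + (1 - r) * s) ^ m) (by fun_prop) 0 1).continuousOn
      · exact (intervalIntegral.continuous_parametric_intervalIntegral_of_continuous'
          (f := fun r s : ℝ => (r + (1 - r) * s) ^ m) (by fun_prop) 0 1).continuousOn
    refine intermediate_value_Icc' zero_le_one cont ⟨?_, ?_⟩
    · simp only [sub_self, zero_mul, add_zero, one_pow, mul_one, intervalIntegral.integral_const,
        integral_id, smul_eq_mul, sub_zero]
      rw [le_div_iff₀ hV0]
      linarith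
    · have i1 := integral_linear_pow (r := 0) zero_ne_one m
      have i2 := integral_id_mul_linear_pow (r := 0) zero_ne_one m
      simp only [i1, i2]
      rw [div_le_iff₀ hV0, zero_pow (by omega), zero_pow (by omega)]
      refine hWle.trans (le_of_eq ?_)
      field_simp
      ring
  set V' := ∫ s in (0 : ℝ)..1, (r + (1 - r) * s) ^ m with hV'
  set W' := ∫ s in (0 : ℝ)..1, s * (r + (1 - r) * s) ^ m with hW'
  have hV'0 : 0 < V' := integral_linear_pow_pos hr0 m
  -- Scaling by `κ` matches the mass, and with it the first moment, since the centroids already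
  -- agree.
  obtain ⟨κ, hκ0, hκ⟩ := root (div_pos hV0 hV'0)
  have eV : V = κ ^ m * V' := by rw [hκ]; field_simp
  have eW : W = κ ^ m * W' := by
    rw [hκ]
    field_simp at hr ⊢
    linarith
  have hlin : ∀ s ∈ Set.Icc (0 : ℝ) 1, 0 ≤ r + (1 - r) * s := fun s hs =>
    add_nonneg hr0 (mul_nonneg (by linarith) hs.1)
  have kc : ConcaveOn ℝ (Set.Icc 0 1) fun s => g s - κ * (r + (1 - r) * s) := by
    refine hc.sub ⟨convex_Icc 0 1, fun x _ y _ a b _ _ hab => le_of_eq ?_⟩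
    simp only [smul_eq_mul]
    linear_combination (-(κ * r)) * hab
  have ends := endpoint_le_of_moments_eq hm0 kc hg (fun s hs => mul_nonneg hκ0.le (hlin s hs)) hgi
    (Continuous.intervalIntegrable (by fun_prop) _ _)
    (by simp only [mul_pow]; rw [← hV, intervalIntegral.integral_const_mul, eV])
    (by
      simp only [mul_pow, mul_left_comm _ (κ ^ m)]
      rw [← hW, intervalIntegral.integral_const_mul, eW])
  simp only [mul_zero, add_zero, mul_one, add_sub_cancel] at ends
  obtain ⟨end0, end1⟩ := ends
  have hlinear := oppositeConeSum_linear hm hr0 hr1 hV' hW'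
  have hVW' : 0 < V - W := by
    have : (m + 1 : ℝ) / (m + 2) * V < V := by
      rw [div_mul_eq_mul_div, div_lt_iff₀ (by positivity)]
      nlinarith
    linarith
  have p0 := pow_le_pow_left₀ (hg 0 mem0) end0 m
  have p1 := pow_le_pow_left₀ (hg 1 mem1) end1 m
  have eX : (V' - W') / ((m + 1) * V' ^ 2) = (V - W) * κ ^ m / ((m + 1) * V ^ 2) := by
    rw [eV, eW]
    field_simp
  have eY : W' * r ^ m / ((m + 1) * V' ^ 2) = W * (κ * r) ^ m / ((m + 1) * V ^ 2) := by
    rw [eV, eW, mul_pow]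
    field_simp
  rw [eX, eY] at hlinear
  have hX0 : 0 ≤ (V - W) * g 1 ^ m / ((m + 1) * V ^ 2) := by
    have := hg 1 mem1
    positivity
  have hY0 : 0 ≤ W * g 0 ^ m / ((m + 1) * V ^ 2) := by
    have := hg 0 mem0
    positivity
  have hXX : (V - W) * g 1 ^ m / ((m + 1) * V ^ 2) ≤ (V - W) * κ ^ m / ((m + 1) * V ^ 2) := by
    gcongr
  have hYY : W * g 0 ^ m / ((m + 1) * V ^ 2) ≤ W * (κ * r) ^ m / ((m + 1) * V ^ 2) := by
    gcongr
  have mono := oppositeConeSum_mono (by omega : 2 ≤ m + 1) hX0 hY0 hXX hYY hlinear.1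
  refine ⟨mono.1.trans hlinear.1, fun heq => ?_⟩
  obtain ⟨ex, ey⟩ := mono.2 (le_antisymm mono.1 (by rw [heq]; exact hlinear.1))
  rw [ex, ey] at heq
  rw [div_left_inj' (by positivity), mul_right_inj' (by positivity)] at ex ey
  have g1 : g 1 = κ := (pow_left_inj₀ (hg 1 mem1) hκ0.le hm0).1 ex
  have g0 : g 0 = κ * r := (pow_left_inj₀ (hg 0 mem0) (by positivity) hm0).1 ey
  rcases hlinear.2 heq with rfl | rfl
  · right
    refine ⟨by rw [g0, mul_zero], ?_⟩
    rw [eV, g1, hV', integral_linear_pow zero_ne_one, zero_pow (by omega)]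
    field_simp
  · left
    rw [mul_one] at g0
    have eV1 : V = κ ^ m := by
      rw [eV, hV']
      simp
    refine ⟨g0.trans g1.symm, ?_, by rw [g1, eV1]⟩
    rw [g1]
    have mem2 : (1 / 2 : ℝ) ∈ Set.Icc (0 : ℝ) 1 := by norm_num
    have hhalf : κ ≤ g (1 / 2) := by
      have := hc.2 mem0 mem1 (show (0 : ℝ) ≤ 1 / 2 by norm_num) (show (0 : ℝ) ≤ 1 / 2 by norm_num)
        (by norm_num)
      rw [g0, g1] at this
      simp only [smul_eq_mul, mul_zero, zero_add, mul_one] at this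
      linarith
    refine (hhalf.eq_or_lt.resolve_right fun hlt => ?_).symm
    -- Concavity spreads a strict excess at `1 / 2` to the whole open interval, which would make the
    -- mass exceed `κ ^ m`.
    have hgt : ∀ s ∈ Set.Ioo (0 : ℝ) 1, κ < g s := by
      intro s hs
      rcases le_total s (1 / 2) with h | h
      · have := hc.2 mem0 mem2 (show 0 ≤ 1 - 2 * s by linarith) (show 0 ≤ 2 * s by linarith [hs.1])
          (by ring)
        rw [g0] at this
        simp only [smul_eq_mul, mul_zero, zero_add] at this
        rw [show 2 * s * (1 / 2) = s by ring] at this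
        nlinarith [hs.1]
      · have := hc.2 mem1 mem2 (show 0 ≤ 2 * s - 1 by linarith)
          (show 0 ≤ 2 - 2 * s by linarith [hs.2]) (by ring)
        rw [g1] at this
        simp only [smul_eq_mul, mul_one] at this
        rw [show 2 * s - 1 + (2 - 2 * s) * (1 / 2) = s by ring] at this
        nlinarith [hs.2]
    have hpos := intervalIntegral.intervalIntegral_pos_of_pos_on (a := 0) (b := 1)
      (f := fun s => g s ^ m - κ ^ m) (hgi.sub intervalIntegrable_const)
      (fun s hs => sub_pos.2 (pow_lt_pow_left₀ (hgt s hs) hκ0.le hm0)) one_pos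
    rw [intervalIntegral.integral_sub hgi intervalIntegrable_const, ← hV, eV1] at hpos
    simp at hpos

/-- The inequality for concave profiles. -/
theorem oppositeConeSum_concave {m : ℕ} (hm : 2 ≤ m) {g : ℝ → ℝ}
    (hc : ConcaveOn ℝ (Set.Icc 0 1) g) (hg : ∀ s ∈ Set.Icc (0 : ℝ) 1, 0 ≤ g s)
    (hgi : IntervalIntegrable (fun s => g s ^ m) volume 0 1) {V W : ℝ}
    (hV : V = ∫ s in (0 : ℝ)..1, g s ^ m) (hW : W = ∫ s in (0 : ℝ)..1, s * g s ^ m) (hV0 : 0 < V) :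
    oppositeConeSum (m + 1) ((V - W) * g 1 ^ m / ((m + 1) * V ^ 2))
        (W * g 0 ^ m / ((m + 1) * V ^ 2)) ≤ 1 ∧
      (oppositeConeSum (m + 1) ((V - W) * g 1 ^ m / ((m + 1) * V ^ 2))
        (W * g 0 ^ m / ((m + 1) * V ^ 2)) = 1 →
        (g 0 = g 1 ∧ g (1 / 2) = g 1 ∧ V = g 1 ^ m) ∨ (g 0 = 0 ∧ V = g 1 ^ m / (m + 1)) ∨
          (g 1 = 0 ∧ V = g 0 ^ m / (m + 1))) := by
  rcases le_total (V / 2) W with h | h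
  · obtain ⟨h1, h2⟩ := oppositeConeSum_concave_aux hm hc hg hgi hV hW hV0 h
    exact ⟨h1, fun he => (h2 he).imp_right Or.inl⟩
  -- Reflecting the profile exchanges `W` with `V - W` and one end with the other.
  · have a := oppositeConeSum_concave_aux (g := fun s => g (1 - s)) (V := V) (W := V - W) hm
      hc.comp_one_sub (fun s hs => hg _ ⟨by linarith [hs.2], by linarith [hs.1]⟩) hgi.comp_one_sub
      (by rw [integral_comp_one_sub fun s => g s ^ m, hV])
      (by rw [integral_id_mul_comp_one_sub hgi, hV, hW]) hV0 (by linarith)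
    simp only [sub_sub_cancel, sub_self, sub_zero] at a
    rw [oppositeConeSum_comm]
    refine ⟨a.1, fun he => ?_⟩
    rcases a.2 he with ⟨b1, b2, b3⟩ | b
    · left
      norm_num at b2 ⊢
      exact ⟨b1.symm, by rw [b2, b1], by rw [b3, b1]⟩
    · exact Or.inr (Or.inr b)

/-! ### Slices of a convex body and hulls of two faces. -/

theorem IsCompact.convexHull_union {E : Type*} [NormedAddCommGroup E] [NormedSpace ℝ E]
    {S T : Set E} (hS : IsCompact S) (hT : IsCompact T) (cS : Convex ℝ S) (cT : Convex ℝ T)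
    (nS : S.Nonempty) (nT : T.Nonempty) : IsCompact (convexHull ℝ (S ∪ T)) := by
  have : convexHull ℝ (S ∪ T) = (fun q : ℝ × E × E => (1 - q.1) • q.2.1 + q.1 • q.2.2) ''
      (Set.Icc 0 1 ×ˢ S ×ˢ T) := by
    rw [cS.convexHull_union cT nS nT]
    ext x
    simp only [mem_convexJoin, segment_eq_image, Set.mem_image, Set.mem_prod, Prod.exists]
    constructor
    · rintro ⟨a, ha, b, hb, r, hr, rfl⟩
      exact ⟨r, a, b, ⟨hr, ha, hb⟩, rfl⟩
    · rintro ⟨r, a, b, ⟨hr, ha, hb⟩, rfl⟩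
      exact ⟨a, ha, b, hb, r, hr, rfl⟩
  rw [this]
  exact (isCompact_Icc.prod (hS.prod hT)).image (by fun_prop)

section Slices

variable {m : ℕ} {C : Set (ℝ × (Fin m → ℝ))}

theorem IsCompact.slice (hC : IsCompact C) (t : ℝ) : IsCompact (Prod.mk t ⁻¹' C) :=
  (hC.image continuous_snd).of_isClosed_subset
    (hC.isClosed.preimage (Continuous.prodMk_right t)) fun _ hy => ⟨_, hy, rfl⟩

theorem Convex.slice (hC : Convex ℝ C) (t : ℝ) : Convex ℝ (Prod.mk t ⁻¹' C) := by
  intro x hx y hy a b ha hb hab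
  have := hC hx hy ha hb hab
  simpa [← add_mul, hab] using this

theorem IsCompact.integrable_slice (hC : IsCompact C) :
    Integrable fun t => volume.real (Prod.mk t ⁻¹' C) := by
  refine integrable_toReal_of_lintegral_ne_top
    (measurable_measure_prodMk_left hC.measurableSet).aemeasurable ?_
  rw [← Measure.prod_apply hC.measurableSet, ← Measure.volume_eq_prod]
  exact hC.measure_ne_top

theorem slice_eq_zero {α β : ℝ} (h : ∀ p ∈ C, p.1 ∈ Set.Icc α β) {t : ℝ} (ht : t ∉ Set.Icc α β) :
    volume.real (Prod.mk t ⁻¹' C) = 0 := by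
  have : Prod.mk t ⁻¹' C = ∅ := by
    rw [Set.eq_empty_iff_forall_notMem]
    exact fun y hy => ht (h _ hy)
  simp [this]

theorem IsCompact.volume_eq_integral_slice (hC : IsCompact C) {α β : ℝ} (hαβ : α ≤ β)
    (h : ∀ p ∈ C, p.1 ∈ Set.Icc α β) :
    volume.real C = ∫ t in α..β, volume.real (Prod.mk t ⁻¹' C) := by
  rw [intervalIntegral.integral_of_le hαβ, ← integral_Icc_eq_integral_Ioc,
    setIntegral_eq_integral_of_forall_compl_eq_zero fun t ht => slice_eq_zero h ht, Measure.real,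
    Measure.volume_eq_prod, Measure.prod_apply hC.measurableSet]
  refine (integral_toReal (measurable_measure_prodMk_left hC.measurableSet).aemeasurable
    (Filter.Eventually.of_forall fun t => ?_)).symm
  exact (hC.slice t).measure_lt_top

theorem IsCompact.integral_fst_eq_integral_slice (hC : IsCompact C) {α β : ℝ} (hαβ : α ≤ β)
    (h : ∀ p ∈ C, p.1 ∈ Set.Icc α β) :
    ∫ p in C, p.1 = ∫ t in α..β, t * volume.real (Prod.mk t ⁻¹' C) := by
  have hR : ∫ t in Set.Icc α β, t * volume.real (Prod.mk t ⁻¹' C) =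
      ∫ t, t * volume.real (Prod.mk t ⁻¹' C) :=
    setIntegral_eq_integral_of_forall_compl_eq_zero fun t ht => by rw [slice_eq_zero h ht, mul_zero]
  rw [intervalIntegral.integral_of_le hαβ, ← integral_Icc_eq_integral_Ioc, hR,
    ← integral_indicator hC.measurableSet, Measure.volume_eq_prod, integral_prod]
  · congr 1
    ext t
    have : (fun y => C.indicator (fun p : ℝ × (Fin m → ℝ) => p.1) (t, y)) =
        (Prod.mk t ⁻¹' C).indicator fun _ => t := by
      ext y
      rfl
    rw [this, integral_indicator (hC.slice t).measurableSet]
    simp [mul_comm]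
  · rw [integrable_indicator_iff hC.measurableSet, ← Measure.volume_eq_prod]
    exact continuous_fst.continuousOn.integrableOn_compact hC

theorem slice_combo_subset (hC : Convex ℝ C) {t u a b : ℝ} (ha : 0 ≤ a) (hb : 0 ≤ b)
    (hab : a + b = 1) : ∀ x ∈ Prod.mk t ⁻¹' C, ∀ y ∈ Prod.mk u ⁻¹' C,
      a • x + b • y ∈ Prod.mk (a * t + b * u) ⁻¹' C := by
  intro x hx y hy
  exact hC hx hy ha hb hab

/-- Brunn's theorem: the `m`-th root of the volume of the slices is concave. -/
theorem concaveOn_slice (hm : m ≠ 0) (hC : IsCompact C) (hc : Convex ℝ C) {α β : ℝ}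
    (hα : (Prod.mk α ⁻¹' C).Nonempty) (hβ : (Prod.mk β ⁻¹' C).Nonempty) :
    ConcaveOn ℝ (Set.Icc 0 1) fun s =>
      volume.real (Prod.mk (α + (β - α) * s) ⁻¹' C) ^ (m⁻¹ : ℝ) := by
  have ne : ∀ s ∈ Set.Icc (0 : ℝ) 1, (Prod.mk (α + (β - α) * s) ⁻¹' C).Nonempty := by
    intro s hs
    obtain ⟨x, hx⟩ := hα
    obtain ⟨y, hy⟩ := hβ
    have := slice_combo_subset hc (sub_nonneg.2 hs.2) hs.1 (by ring) x hx y hy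
    rw [show (1 - s) * α + s * β = α + (β - α) * s by ring] at this
    exact ⟨_, this⟩
  rw [concaveOn_iff_forall_pos]
  refine ⟨convex_Icc 0 1, fun x hx y hy a b ha hb hab => ?_⟩
  refine brunn_minkowski hm (hC.slice _) (hC.slice _) (hC.slice _) (ne x hx) (ne y hy) ha hb ?_
  have := slice_combo_subset (t := α + (β - α) * x) (u := α + (β - α) * y) hc ha.le hb.le hab
  rwa [show a * (α + (β - α) * x) + b * (α + (β - α) * y) = α + (β - α) * (a • x + b • y) by
    simp only [smul_eq_mul]; linear_combination α * hab] at this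

theorem integral_slice_rescale {α β : ℝ} (f : ℝ → ℝ) :
    ∫ t in α..β, f t = (β - α) * ∫ s in (0 : ℝ)..1, f (α + (β - α) * s) := by
  rw [intervalIntegral.mul_integral_comp_add_mul]
  simp

theorem IsCompact.intervalIntegrable_slice (hC : IsCompact C) (α β : ℝ) :
    IntervalIntegrable (fun s => volume.real (Prod.mk (α + (β - α) * s) ⁻¹' C)) volume 0 1 := by
  rcases eq_or_ne (β - α) 0 with h | h
  · simp [h]
  · have := (hC.integrable_slice.comp_mul_left' h).comp_add_left (α / (β - α))
    refine (this.congr (Filter.Eventually.of_forall fun s => ?_)).intervalIntegrable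
    simp only
    rw [show (β - α) * (α / (β - α) + s) = α + (β - α) * s by field_simp]

/-- A lower bound for the volume of the convex hull of two parallel slices. -/
theorem le_volume_of_slices (hm : m ≠ 0) (hC : IsCompact C) (hc : Convex ℝ C) {α β : ℝ}
    (hαβ : α ≤ β) (h : ∀ p ∈ C, p.1 ∈ Set.Icc α β) (hα : (Prod.mk α ⁻¹' C).Nonempty)
    (hβ : (Prod.mk β ⁻¹' C).Nonempty) {a b : ℝ} (ha : 0 ≤ a) (hb : 0 ≤ b)
    (haC : a ^ m ≤ volume.real (Prod.mk α ⁻¹' C)) (hbC : b ^ m ≤ volume.real (Prod.mk β ⁻¹' C)) :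
    (β - α) * ∫ s in (0 : ℝ)..1, ((1 - s) * a + s * b) ^ m ≤ volume.real C := by
  have conc := concaveOn_slice hm hC hc hα hβ
  rw [hC.volume_eq_integral_slice hαβ h,
    integral_slice_rescale fun t => volume.real (Prod.mk t ⁻¹' C)]
  refine mul_le_mul_of_nonneg_left ?_ (sub_nonneg.2 hαβ)
  have root : ∀ {v w : ℝ}, 0 ≤ v → v ^ m ≤ w → v ≤ w ^ (m⁻¹ : ℝ) := by
    intro v w hv hvw
    rw [← Real.pow_rpow_inv_natCast hv hm]
    exact Real.rpow_le_rpow (by positivity) hvw (by positivity)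
  refine intervalIntegral.integral_mono_on zero_le_one
    (Continuous.intervalIntegrable (by fun_prop) _ _) (hC.intervalIntegrable_slice α β)
    fun s hs => ?_
  have := conc.2 (x := 0) (y := 1) (by simp) (by simp) (sub_nonneg.2 hs.2) hs.1 (by ring)
  simp only [smul_eq_mul, mul_zero, zero_add, mul_one, add_zero, add_sub_cancel] at this
  have key : (1 - s) * a + s * b ≤ volume.real (Prod.mk (α + (β - α) * s) ⁻¹' C) ^ (m⁻¹ : ℝ) :=
    le_trans (add_le_add (mul_le_mul_of_nonneg_left (root ha haC) (sub_nonneg.2 hs.2))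
      (mul_le_mul_of_nonneg_left (root hb hbC) hs.1)) this
  have h0 : 0 ≤ (1 - s) * a + s * b :=
    add_nonneg (mul_nonneg (sub_nonneg.2 hs.2) ha) (mul_nonneg hs.1 hb)
  calc _ ≤ (volume.real (Prod.mk (α + (β - α) * s) ⁻¹' C) ^ (m⁻¹ : ℝ)) ^ m :=
        pow_le_pow_left₀ h0 key m
    _ = _ := Real.rpow_inv_natCast_pow measureReal_nonneg hm

/-- A convex body is the convex hull of two of its slices if this convex hull has the right
volume. -/
theorem eq_convexHull_of_volume_le (hm : m ≠ 0) (hC : IsCompact C) (hc : Convex ℝ C)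
    (hi : (interior C).Nonempty) {α β : ℝ} (hαβ : α ≤ β) {A B : Set (Fin m → ℝ)}
    (hA : IsCompact A) (hB : IsCompact B) (cA : Convex ℝ A) (cB : Convex ℝ B) (hA0 : A.Nonempty) (hB0 : B.Nonempty)
    (hAC : A ⊆ Prod.mk α ⁻¹' C) (hBC : B ⊆ Prod.mk β ⁻¹' C) {a b : ℝ} (ha : 0 ≤ a) (hb : 0 ≤ b)
    (haA : a ^ m ≤ volume.real A) (hbB : b ^ m ≤ volume.real B)
    (hV : volume.real C ≤ (β - α) * ∫ s in (0 : ℝ)..1, ((1 - s) * a + s * b) ^ m) :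
    C = convexHull ℝ (({α} ×ˢ A) ∪ ({β} ×ˢ B)) := by
  set D := convexHull ℝ (({α} ×ˢ A) ∪ ({β} ×ˢ B)) with hD
  have hDc : IsCompact D :=
    (isCompact_singleton.prod hA).convexHull_union (isCompact_singleton.prod hB)
      ((convex_singleton α).prod cA) ((convex_singleton β).prod cB)
      ((Set.singleton_nonempty α).prod hA0) ((Set.singleton_nonempty β).prod hB0)
  have hsub : D ⊆ C := by
    refine convexHull_min ?_ hc
    rintro ⟨t, x⟩ (⟨ht, hx⟩ | ⟨ht, hx⟩)
    · obtain rfl : t = α := ht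
      exact hAC hx
    · obtain rfl : t = β := ht
      exact hBC hx
  have hDI : ∀ p ∈ D, p.1 ∈ Set.Icc α β := by
    have : D ⊆ Prod.fst ⁻¹' Set.Icc α β := by
      refine convexHull_min ?_ ((convex_Icc α β).linear_preimage (LinearMap.fst ℝ ℝ _))
      rintro ⟨t, x⟩ (⟨ht, hx⟩ | ⟨ht, hx⟩)
      · obtain rfl : t = α := ht
        exact ⟨le_rfl, hαβ⟩
      · obtain rfl : t = β := ht
        exact ⟨hαβ, le_rfl⟩
    exact this
  have hAD : A ⊆ Prod.mk α ⁻¹' D := fun x hx => subset_convexHull ℝ _ (Or.inl ⟨rfl, hx⟩)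
  have hBD : B ⊆ Prod.mk β ⁻¹' D := fun x hx => subset_convexHull ℝ _ (Or.inr ⟨rfl, hx⟩)
  -- Brunn's lower bound applied to the hull `D` itself already reaches the volume of `C`.
  have := le_volume_of_slices hm hDc (convex_convexHull ℝ _) hαβ hDI (hA0.mono hAD)
    (hB0.mono hBD) ha hb
    (haA.trans (measureReal_mono hAD (hDc.slice α).measure_ne_top))
    (hbB.trans (measureReal_mono hBD (hDc.slice β).measure_ne_top))
  refine (hc.eq_of_subset_of_measure_le volume hi hDc.isClosed hsub hC.measure_ne_top ?_).symm
  exact (ENNReal.toReal_le_toReal hC.measure_ne_top hDc.measure_ne_top).1 (hV.trans this)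

/-- The inequality for convex bodies in `ℝ × ℝᵐ` and the two extreme slices. -/
theorem oppositeConeSum_slice (hm : 2 ≤ m) (hC : IsCompact C) (hc : Convex ℝ C)
    (hi : (interior C).Nonempty) (hcen : ∫ p in C, p.1 = 0) {α β : ℝ}
    (h : ∀ p ∈ C, p.1 ∈ Set.Icc α β) (hα : (Prod.mk α ⁻¹' C).Nonempty)
    (hβ : (Prod.mk β ⁻¹' C).Nonempty) {x y : ℝ}
    (hx : x = β * volume.real (Prod.mk β ⁻¹' C) / ((m + 1) * volume.real C))
    (hy : y = -α * volume.real (Prod.mk α ⁻¹' C) / ((m + 1) * volume.real C)) :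
    α < β ∧ α ≤ 0 ∧ 0 ≤ β ∧ oppositeConeSum (m + 1) x y ≤ 1 ∧
      (oppositeConeSum (m + 1) x y = 1 →
        (0 < volume.real (Prod.mk α ⁻¹' C) ∧
          (∃ v, Prod.mk β ⁻¹' C = (fun z => z + v) '' (Prod.mk α ⁻¹' C)) ∧
          C = convexHull ℝ (({α} ×ˢ (Prod.mk α ⁻¹' C)) ∪ ({β} ×ˢ (Prod.mk β ⁻¹' C)))) ∨
        (0 < volume.real (Prod.mk β ⁻¹' C) ∧
          ∃ z, C = convexHull ℝ (({β} ×ˢ (Prod.mk β ⁻¹' C)) ∪ {(α, z)})) ∨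
        (0 < volume.real (Prod.mk α ⁻¹' C) ∧
          ∃ z, C = convexHull ℝ (({α} ×ˢ (Prod.mk α ⁻¹' C)) ∪ {(β, z)}))) := by
  have hm0 : m ≠ 0 := by omega
  have hV0 : 0 < volume.real C := ENNReal.toReal_pos
    ((isOpen_interior.measure_pos volume hi).trans_le (measure_mono interior_subset)).ne'
    hC.measure_ne_top
  have hαβ : α ≤ β := by
    obtain ⟨z, hz⟩ := hα
    exact (h _ hz).2
  have hV := hC.volume_eq_integral_slice hαβ h
  have hlt : α < β := by
    refine hαβ.lt_of_ne ?_
    rintro rfl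
    rw [hV, intervalIntegral.integral_same] at hV0
    exact lt_irrefl _ hV0
  have hL : 0 < β - α := sub_pos.2 hlt
  set g : ℝ → ℝ := fun s => volume.real (Prod.mk (α + (β - α) * s) ⁻¹' C) ^ (m⁻¹ : ℝ) with hg
  have gpow : ∀ s, g s ^ m = volume.real (Prod.mk (α + (β - α) * s) ⁻¹' C) := fun s =>
    Real.rpow_inv_natCast_pow measureReal_nonneg hm0
  have gnn : ∀ s, 0 ≤ g s := fun s => Real.rpow_nonneg measureReal_nonneg _
  have g0 : g 0 ^ m = volume.real (Prod.mk α ⁻¹' C) := by rw [gpow]; simp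
  have g1 : g 1 ^ m = volume.real (Prod.mk β ⁻¹' C) := by rw [gpow]; simp
  have int : IntervalIntegrable (fun s => g s ^ m) volume 0 1 := by
    simp only [gpow]
    exact hC.intervalIntegrable_slice α β
  set V := ∫ s in (0 : ℝ)..1, g s ^ m with hVdef
  set W := ∫ s in (0 : ℝ)..1, s * g s ^ m with hWdef
  have eV : volume.real C = (β - α) * V := by
    rw [hV, integral_slice_rescale, hVdef]
    simp only [gpow]
  -- The centroid condition in the rescaled height. It gives `-α * V = (β - α) * W` and `β * V = (β
  -- - α) * (V - W)`, hence the signs of `α` and `β` and the two cone volumes.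
  have eW : α * V + (β - α) * W = 0 := by
    have h1 := hC.integral_fst_eq_integral_slice hαβ h
    rw [hcen, integral_slice_rescale] at h1
    have h2 := (mul_eq_zero.1 h1.symm).resolve_left hL.ne'
    have e : (fun s : ℝ => (α + (β - α) * s) * volume.real (Prod.mk (α + (β - α) * s) ⁻¹' C)) =
        fun s => α * g s ^ m + (β - α) * (s * g s ^ m) := by
      ext s
      rw [gpow]
      ring
    rw [e, intervalIntegral.integral_add (int.const_mul _)
      ((int.continuousOn_mul (g := fun s => s) continuousOn_id).const_mul _),
      intervalIntegral.integral_const_mul, intervalIntegral.integral_const_mul] at h2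
    exact h2
  have hVpos : 0 < V := by
    rw [eV] at hV0
    exact pos_of_mul_pos_right hV0 hL.le
  have hW0 : 0 ≤ W := intervalIntegral.integral_nonneg zero_le_one fun s hs =>
    mul_nonneg hs.1 (pow_nonneg (gnn s) m)
  have hWV : W ≤ V := intervalIntegral.integral_mono_on zero_le_one
    (int.continuousOn_mul (g := fun s => s) continuousOn_id) int fun s hs =>
      mul_le_of_le_one_left (pow_nonneg (gnn s) m) hs.2
  have hα0 : α ≤ 0 := by
    by_contra hcon
    push Not at hcon
    nlinarith [mul_pos hcon hVpos, mul_nonneg hL.le hW0]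
  have hβ0 : 0 ≤ β := by
    by_contra hcon
    push Not at hcon
    nlinarith [mul_pos (neg_pos.2 hcon) hVpos, mul_nonneg hL.le (sub_nonneg.2 hWV)]
  have main := oppositeConeSum_concave (g := g) hm (concaveOn_slice hm0 hC hc hα hβ) (fun s _ => gnn s) int
    hVdef hWdef hVpos
  have ex : (V - W) * g 1 ^ m / ((m + 1) * V ^ 2) = x := by
    rw [hx, eV, ← g1, div_eq_div_iff (by positivity) (by positivity)]
    linear_combination (-(g 1 ^ m) * (m + 1) * V) * eW
  have ey : W * g 0 ^ m / ((m + 1) * V ^ 2) = y := by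
    rw [hy, eV, ← g0, div_eq_div_iff (by positivity) (by positivity)]
    linear_combination (g 0 ^ m * (m + 1) * V) * eW
  rw [ex, ey] at main
  have ivs : ∫ s in (0 : ℝ)..1, s ^ m = 1 / (m + 1) := by simp
  refine ⟨hlt, hα0, hβ0, main.1, fun heq => ?_⟩
  rcases main.2 heq with ⟨h01, hhalf, hVg⟩ | ⟨h0, hVg⟩ | ⟨h1, hVg⟩
  · left
    have pos : 0 < volume.real (Prod.mk α ⁻¹' C) := by
      rw [← g0, h01, ← hVg]
      exact hVpos
    -- The middle slice has the same volume as the ends and contains all midpoints between them, as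
    -- the equality case requires.
    have ghalf := gpow (1 / 2)
    rw [show α + (β - α) * (1 / 2) = 1 / 2 * α + 1 / 2 * β by ring, hhalf, ← h01, g0] at ghalf
    refine ⟨pos, ?_, ?_⟩
    · refine exists_translate_of_volume_eq (hC.slice α) (hC.slice β)
        (hC.slice (1 / 2 * α + 1 / 2 * β)) (hc.slice α) (hc.slice β) pos (by rw [← g1, ← h01, g0])
        ghalf.symm ?_
      exact slice_combo_subset hc (by norm_num) (by norm_num) (by norm_num)
    · refine eq_convexHull_of_volume_le hm0 hC hc hi hαβ (hC.slice α) (hC.slice β)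
        (hc.slice α) (hc.slice β) hα hβ subset_rfl
        subset_rfl (gnn 0) (gnn 1) g0.le g1.le ?_
      rw [eV, hVg, h01]
      have : ∀ s : ℝ, ((1 - s) * g 1 + s * g 1) ^ m = g 1 ^ m := fun s => by ring
      simp [this]
  · right; left
    refine ⟨by rw [← g1]; nlinarith [show V * (m + 1) = g 1 ^ m by rw [hVg]; field_simp], ?_⟩
    obtain ⟨z, hz⟩ := hα
    refine ⟨z, ?_⟩
    -- Any point `z` of the bottom slice serves as apex: the cone from it over the top slice already
    -- has the volume of `C`.
    have := eq_convexHull_of_volume_le hm0 hC hc hi hαβ (isCompact_singleton (x := z))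
      (hC.slice β) (convex_singleton z) (hc.slice β) (Set.singleton_nonempty z) hβ (Set.singleton_subset_iff.2 hz) subset_rfl le_rfl
      (gnn 1) (by rw [zero_pow hm0]; exact measureReal_nonneg) g1.le (by
        rw [eV, hVg]
        simp only [mul_zero, zero_add, mul_pow]
        rw [intervalIntegral.integral_mul_const, ivs]
        exact le_of_eq (by ring))
    rwa [Set.singleton_prod_singleton, Set.union_comm] at this
  · right; right
    refine ⟨by rw [← g0]; nlinarith [show V * (m + 1) = g 0 ^ m by rw [hVg]; field_simp], ?_⟩
    obtain ⟨z, hz⟩ := hβ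
    refine ⟨z, ?_⟩
    have ivs' : ∫ s in (0 : ℝ)..1, (1 - s) ^ m = 1 / (m + 1) := by
      rw [integral_comp_one_sub fun s => s ^ m, ivs]
    have := eq_convexHull_of_volume_le hm0 hC hc hi hαβ (hC.slice α)
      (isCompact_singleton (x := z)) (hc.slice α) (convex_singleton z) hα (Set.singleton_nonempty z) subset_rfl
      (Set.singleton_subset_iff.2 hz) (gnn 0) le_rfl g0.le
      (by rw [zero_pow hm0]; exact measureReal_nonneg) (by
        rw [eV, hVg]
        simp only [mul_zero, add_zero, mul_pow]
        rw [intervalIntegral.integral_mul_const, ivs']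
        exact le_of_eq (by ring))
    rwa [Set.singleton_prod_singleton] at this

end Slices

/-! ### Passage from `K` to coordinates adapted to `u`. -/

namespace LogMinkowski

variable {m : ℕ}

/-- Orthonormal coordinates on `ℝᵐ⁺¹` whose first coordinate is `⟪u, ·⟫`. -/
theorem exists_coordinates (u : sphere (0 : EuclideanSpace ℝ (Fin (m + 1))) 1) :
    ∃ Ψ : EuclideanSpace ℝ (Fin (m + 1)) ≃L[ℝ] ℝ × (Fin m → ℝ), MeasurePreserving Ψ ∧
      (∀ x, (Ψ x).1 = ⟪(u : EuclideanSpace ℝ (Fin (m + 1))), x⟫) ∧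
      ∀ t S, μHE[m] (Ψ.symm '' ({t} ×ˢ S)) = volume S := by
  have hu : ‖(u : EuclideanSpace ℝ (Fin (m + 1)))‖ = 1 := mem_sphere_zero_iff_norm.1 u.2
  have ho : Orthonormal ℝ (({0} : Set (Fin (m + 1))).domRestrict
      fun _ => (u : EuclideanSpace ℝ (Fin (m + 1)))) := by
    refine ⟨fun _ => hu, fun i j hij => ?_⟩
    exact absurd (Subsingleton.elim i j) hij
  obtain ⟨b, hb⟩ := ho.exists_orthonormalBasis_extension_of_card_eq (by simp)
  have hb0 : b 0 = u := hb 0 rfl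
  let cl : (ℝ × (Fin m → ℝ)) ≃L[ℝ] (Fin (m + 1) → ℝ) :=
    (Fin.consLinearEquiv ℝ (fun _ : Fin (m + 1) => ℝ)).toContinuousLinearEquiv
  let Ψ : EuclideanSpace ℝ (Fin (m + 1)) ≃L[ℝ] ℝ × (Fin m → ℝ) :=
    (b.repr.toContinuousLinearEquiv.trans (EuclideanSpace.equiv (Fin (m + 1)) ℝ)).trans cl.symm
  have hΨs : ∀ p, Ψ.symm p = b.repr.symm (WithLp.toLp 2 (Fin.cons (α := fun _ => ℝ) p.1 p.2)) :=
    fun _ => rfl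
  have hΨ : ∀ x, Ψ x = (b.repr x 0, fun i => b.repr x i.succ) := fun _ => rfl
  refine ⟨Ψ, ?_, fun x => ?_, fun t S => ?_⟩
  · have h := (volume_preserving_piFinSuccAbove (fun _ : Fin (m + 1) => ℝ) 0).comp
      ((PiLp.volume_preserving_ofLp (Fin (m + 1))).comp b.measurePreserving_repr)
    exact h
  · rw [hΨ, ← hb0]
    exact b.repr_apply_apply x 0
  -- An isometric embedding onto the hyperplane at height `t`; isometries preserve Hausdorff
  -- measure, which is Lebesgue measure on `ℝᵐ`.
  · let j : EuclideanSpace ℝ (Fin m) → EuclideanSpace ℝ (Fin (m + 1)) :=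
      fun w => Ψ.symm (t, WithLp.ofLp w)
    have hj : Isometry j := by
      refine Isometry.of_dist_eq fun w w' => ?_
      simp only [j, hΨs]
      rw [b.repr.symm.dist_map, EuclideanSpace.dist_eq, EuclideanSpace.dist_eq, Fin.sum_univ_succ]
      simp
    have himg : Ψ.symm '' ({t} ×ˢ S) = j '' (WithLp.ofLp ⁻¹' S) := by
      ext x
      constructor
      · rintro ⟨⟨t', y⟩, ⟨ht, hy⟩, rfl⟩
        obtain rfl : t' = t := ht
        exact ⟨WithLp.toLp 2 y, hy, rfl⟩
      · rintro ⟨w, hw, rfl⟩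
        exact ⟨(t, WithLp.ofLp w), ⟨rfl, hw⟩, rfl⟩
    rw [himg, hj.euclideanHausdorffMeasure_image,
      EuclideanSpace.euclideanHausdorffMeasure_eq_volume]
    exact (PiLp.volume_preserving_ofLp (Fin m)).measure_preimage_equiv
      (f := (MeasurableEquiv.toLp 2 (Fin m → ℝ)).symm) S

/-- The cone-volume measure of a direction is at most the volume of the cone over the facet in
this direction. -/
theorem coneVolumeMeasure_real_singleton_le (K : ConvexBody (EuclideanSpace ℝ (Fin (m + 1))))
    (v : sphere (0 : EuclideanSpace ℝ (Fin (m + 1))) 1) {h : ℝ} (h0 : 0 ≤ h)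
    (hle : ∀ x ∈ K, ⟪(v : EuclideanSpace ℝ (Fin (m + 1))), x⟫ ≤ h)
    (hat : ∃ x ∈ K, ⟪(v : EuclideanSpace ℝ (Fin (m + 1))), x⟫ = h) {A : ℝ≥0∞} (hA : A ≠ ∞)
    (hfacet : μHE[m] {x | x ∈ K ∧ ⟪(v : EuclideanSpace ℝ (Fin (m + 1))), x⟫ = h} = A) :
    (coneVolumeMeasure K).real {v} ≤ h * A.toReal / (m + 1) := by
  have hm := (continuous_gaussMap K).measurable
  obtain ⟨x₀, hx₀, hx₀h⟩ := hat
  have on_facet : ∀ x ∈ gaussMap K ⁻¹' {v},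
      ⟪(x : EuclideanSpace ℝ (Fin (m + 1))), (v : EuclideanSpace ℝ (Fin (m + 1)))⟫ = h := by
    intro x hx
    have h1 := isOuterUnitNormal_gaussMap K x x₀ hx₀
    rw [show gaussMap K x = v from hx] at h1
    rw [real_inner_comm] at hx₀h
    have h2 := hle x (regularBoundary_subset K x.2)
    rw [real_inner_comm] at h2
    linarith
  -- Points with Gauss image `v` lie on the facet, where the integrand is the constant `h`. The
  -- reverse inclusion is not needed, since `oppositeConeSum_mono` takes upper bounds.
  have key : coneVolumeMeasure K {v} ≤ ((m + 1 : ℕ) : ℝ≥0∞)⁻¹ * (ENNReal.ofReal h * A) := by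
    rw [coneVolumeMeasure_apply K (measurableSet_singleton v)]
    gcongr
    refine (setLIntegral_mono' (g := fun _ => ENNReal.ofReal h)
      (hm (measurableSet_singleton v)) (fun x hx => ?_)).trans ?_
    · rw [show gaussMap K x = v from hx, on_facet x hx]
    · rw [setLIntegral_const, (MeasurableEmbedding.subtype_coe
        (measurableSet_regularBoundary K)).comap_apply, ← hfacet]
      refine mul_le_mul_right (measure_mono ?_) _
      rintro _ ⟨x, hx, rfl⟩
      refine ⟨regularBoundary_subset K x.2, ?_⟩
      rw [real_inner_comm]
      exact on_facet x hx
  have hfin : ((m + 1 : ℕ) : ℝ≥0∞)⁻¹ * (ENNReal.ofReal h * A) ≠ ∞ :=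
    ENNReal.mul_ne_top (by simp) (ENNReal.mul_ne_top ENNReal.ofReal_ne_top hA)
  refine (ENNReal.toReal_mono hfin key).trans (le_of_eq ?_)
  rw [ENNReal.toReal_mul, ENNReal.toReal_mul, ENNReal.toReal_inv, ENNReal.toReal_natCast,
    ENNReal.toReal_ofReal h0]
  push_cast
  ring

/-- Slices of positive volume give `m`-dimensional convex bodies in hyperplanes. -/
theorem exists_isHyperplaneBody (u : sphere (0 : EuclideanSpace ℝ (Fin (m + 1))) 1)
    {Ψ : EuclideanSpace ℝ (Fin (m + 1)) ≃L[ℝ] ℝ × (Fin m → ℝ)}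
    (hΨ : ∀ x, (Ψ x).1 = ⟪(u : EuclideanSpace ℝ (Fin (m + 1))), x⟫) {S : Set (Fin m → ℝ)}
    (hS : IsCompact S) (hc : Convex ℝ S) (hpos : 0 < volume.real S) (t : ℝ) :
    ∃ P : ConvexBody (EuclideanSpace ℝ (Fin (m + 1))),
      (P : Set (EuclideanSpace ℝ (Fin (m + 1)))) = Ψ.symm '' ({t} ×ˢ S) ∧
        IsHyperplaneBody P u t := by
  have hne : S.Nonempty := by
    rw [Set.nonempty_iff_ne_empty]
    rintro rfl
    simp at hpos
  let P : ConvexBody (EuclideanSpace ℝ (Fin (m + 1))) :=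
    { carrier := Ψ.symm '' ({t} ×ˢ S)
      convex' := ((convex_singleton t).prod hc).linear_image Ψ.symm.toLinearMap
      isCompact' := (isCompact_singleton.prod hS).image Ψ.symm.continuous
      nonempty' := ((Set.singleton_nonempty t).prod hne).image _ }
  refine ⟨P, rfl, ?_, ?_⟩
  · rintro _ ⟨⟨t', y⟩, ⟨ht, _⟩, rfl⟩
    change ⟪(u : EuclideanSpace ℝ (Fin (m + 1))), Ψ.symm (t', y)⟫ = t
    rw [← hΨ, ContinuousLinearEquiv.apply_symm_apply]
    exact ht
  · have hint : (interior S).Nonempty :=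
      hc.nonempty_interior_of_measure_ne_zero volume fun h => by simp [Measure.real, h] at hpos
    -- Positive volume gives `S` interior and hence full direction space; the injective linear part
    -- of `f` carries the dimension `m` over.
    have htop : vectorSpan ℝ S = ⊤ := AffineSubspace.vectorSpan_eq_top_of_affineSpan_eq_top ℝ _ _
      (hc.interior_nonempty_iff_affineSpan_eq_top.1 hint)
    let L : (Fin m → ℝ) →ₗ[ℝ] EuclideanSpace ℝ (Fin (m + 1)) :=
      Ψ.symm.toLinearMap ∘ₗ LinearMap.inr ℝ ℝ (Fin m → ℝ)
    have hL : Function.Injective L := Ψ.symm.injective.comp LinearMap.inr_injective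
    let f : (Fin m → ℝ) →ᵃ[ℝ] EuclideanSpace ℝ (Fin (m + 1)) :=
      L.toAffineMap + AffineMap.const ℝ _ (Ψ.symm (t, 0))
    have himg : Ψ.symm '' ({t} ×ˢ S) = f '' S := by
      have hf : ∀ y, f y = Ψ.symm (t, y) := by
        intro y
        change Ψ.symm (0, y) + Ψ.symm (t, 0) = _
        rw [← map_add]
        simp
      ext x
      constructor
      · rintro ⟨⟨t', y⟩, ⟨ht, hy⟩, rfl⟩
        obtain rfl : t' = t := ht
        exact ⟨y, hy, hf y⟩
      · rintro ⟨y, hy, rfl⟩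
        exact ⟨(t, y), ⟨rfl, hy⟩, (hf y).symm⟩
    change Module.finrank ℝ (vectorSpan ℝ (Ψ.symm '' ({t} ×ˢ S))) = m + 1 - 1
    have hlin : f.linear = L := by simp [f]
    rw [himg, ← AffineMap.map_vectorSpan, htop, hlin, Submodule.map_top,
      LinearMap.finrank_range_of_inj hL]
    simp

end LogMinkowski

/-! ### The inequality and its equality cases for `K`. -/

theorem theorem1p1 (n : ℕ) (hn : 3 ≤ n) (K : ConvexBody (EuclideanSpace ℝ (Fin n)))
    (hK : (interior (K : Set (EuclideanSpace ℝ (Fin n)))).Nonempty)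
    (hcentroid : LogMinkowski.centroid K = 0)
    (μ : Measure (sphere (0 : EuclideanSpace ℝ (Fin n)) 1))
    (hμ : μ = LogMinkowski.coneVolumeMeasure K)
    (V : ℝ) (hV : V = volume.real (K : Set (EuclideanSpace ℝ (Fin n))))
    (u : sphere (0 : EuclideanSpace ℝ (Fin n)) 1) :
    (n : ℝ) * ((μ.real {u} + μ.real {-u}) / V)
        + ((n : ℝ) + 1) ^ (n - 1) * |(μ.real {u} - μ.real {-u}) / V| ^ n ≤ 1 ∧
      ((n : ℝ) * ((μ.real {u} + μ.real {-u}) / V)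
          + ((n : ℝ) + 1) ^ (n - 1) * |(μ.real {u} - μ.real {-u}) / V| ^ n = 1 →
        LogMinkowski.IsObliquePrism K u ∨ LogMinkowski.IsCone K u) := by
  obtain ⟨m, rfl⟩ : ∃ m, n = m + 1 := ⟨n - 1, by omega⟩
  have hm : 2 ≤ m := by omega
  obtain ⟨Ψ, hΨm, hΨu, hΨH⟩ := LogMinkowski.exists_coordinates u
  set C : Set (ℝ × (Fin m → ℝ)) := Ψ '' (K : Set (EuclideanSpace ℝ (Fin (m + 1)))) with hC
  have hCK : (K : Set (EuclideanSpace ℝ (Fin (m + 1)))) = Ψ.symm '' C := by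
    rw [hC, Set.image_image]
    simp
  have hemb : MeasurableEmbedding Ψ := Ψ.toHomeomorph.measurableEmbedding
  have Cc : IsCompact C := K.isCompact.image Ψ.continuous
  have Cconv : Convex ℝ C := K.convex.linear_image Ψ.toLinearMap
  have Ci : (interior C).Nonempty := by
    have := Ψ.toHomeomorph.image_interior (K : Set (EuclideanSpace ℝ (Fin (m + 1))))
    have h2 : (Ψ.toHomeomorph '' interior (K : Set (EuclideanSpace ℝ (Fin (m + 1))))).Nonempty :=
      hK.image _
    rw [this] at h2
    exact h2
  have hvol : volume.real C = V := by
    rw [hV, Measure.real, Measure.real, ← hΨm.measure_preimage_emb hemb, hC,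
      Set.preimage_image_eq _ Ψ.injective]
  have hV0 : 0 < V := by
    rw [hV]
    exact ENNReal.toReal_pos ((isOpen_interior.measure_pos volume hK).trans_le
      (measure_mono interior_subset)).ne' K.isCompact.measure_ne_top
  have hcen : ∫ p in C, p.1 = 0 := by
    have hint : ∫ x in (K : Set (EuclideanSpace ℝ (Fin (m + 1)))), x = 0 := by
      rw [LogMinkowski.centroid, ← hV] at hcentroid
      exact (smul_eq_zero.1 hcentroid).resolve_left (inv_ne_zero hV0.ne')
    rw [hC, hΨm.setIntegral_image_emb hemb]
    simp only [hΨu]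
    have hi : IntegrableOn (fun x => x) (K : Set (EuclideanSpace ℝ (Fin (m + 1)))) :=
      continuous_id.continuousOn.integrableOn_compact K.isCompact
    rw [integral_inner hi (u : EuclideanSpace ℝ (Fin (m + 1))), hint, inner_zero_right]
  have Cne : C.Nonempty := K.nonempty.image _
  -- The extreme heights: the slices at `β` and `α` are the faces of `K` in the directions `u` and
  -- `-u`.
  obtain ⟨pα, hpα, hα⟩ := Cc.exists_isMinOn Cne continuous_fst.continuousOn
  obtain ⟨pβ, hpβ, hβ⟩ := Cc.exists_isMaxOn Cne continuous_fst.continuousOn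
  obtain ⟨hlt, hα0, hβ0, hmain, heq⟩ := oppositeConeSum_slice hm Cc Cconv Ci hcen
    (fun p hp => ⟨hα hp, hβ hp⟩) ⟨pα.2, hpα⟩ ⟨pβ.2, hpβ⟩ rfl rfl
  set α := pα.1
  set β := pβ.1
  have facet : ∀ t : ℝ, μHE[m] {x | x ∈ K ∧ ⟪(u : EuclideanSpace ℝ (Fin (m + 1))), x⟫ = t} =
      volume (Prod.mk t ⁻¹' C) := by
    intro t
    rw [← hΨH t]
    congr 1
    ext x
    constructor
    · rintro ⟨hx, hxt⟩
      refine ⟨Ψ x, ⟨(hΨu x).trans hxt, ?_⟩, Ψ.symm_apply_apply x⟩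
      refine ⟨x, hx, ?_⟩
      rw [← hxt, ← hΨu]
    · rintro ⟨⟨t', y⟩, ⟨ht, hy⟩, rfl⟩
      obtain rfl : t' = t := ht
      refine ⟨?_, by rw [← hΨu, Ψ.apply_symm_apply]⟩
      have : Ψ.symm (t', y) ∈ Ψ.symm '' C := ⟨_, hy, rfl⟩
      rw [← hCK] at this
      exact this
  have memC : ∀ x ∈ K, Ψ x ∈ C := fun x hx => ⟨x, hx, rfl⟩
  have memK : ∀ p ∈ C, Ψ.symm p ∈ K := by
    rintro _ ⟨x, hx, rfl⟩
    rw [Ψ.symm_apply_apply]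
    exact hx
  have hu1 : μ.real {u} ≤ β * volume.real (Prod.mk β ⁻¹' C) / (m + 1) := by
    rw [hμ]
    refine LogMinkowski.coneVolumeMeasure_real_singleton_le K u hβ0 (fun x hx => ?_)
      ⟨Ψ.symm pβ, memK _ hpβ, by rw [← hΨu, Ψ.apply_symm_apply]⟩ (Cc.slice β).measure_ne_top
      (facet β)
    rw [← hΨu]
    exact hβ (memC x hx)
  have hu2 : μ.real {-u} ≤ -α * volume.real (Prod.mk α ⁻¹' C) / (m + 1) := by
    rw [hμ]
    have hneg : ∀ x, ⟪((-u : sphere (0 : EuclideanSpace ℝ (Fin (m + 1))) 1) :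
        EuclideanSpace ℝ (Fin (m + 1))), x⟫ = -(Ψ x).1 := by
      intro x
      rw [hΨu, coe_neg_sphere, inner_neg_left]
    refine LogMinkowski.coneVolumeMeasure_real_singleton_le K (-u) (neg_nonneg.2 hα0)
      (fun x hx => ?_) ⟨Ψ.symm pα, memK _ hpα, by rw [hneg, Ψ.apply_symm_apply]⟩
      (Cc.slice α).measure_ne_top ?_
    · rw [hneg]
      exact neg_le_neg (hα (memC x hx))
    · rw [← facet α]
      congr 1
      ext x
      simp only [Set.mem_ofPred_eq, hneg, neg_inj, hΨu]
  have bound : ∀ {a t : ℝ}, a ≤ t / (m + 1) → a / V ≤ t / ((m + 1) * volume.real C) := by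
    intro a t h
    rw [hvol, ← div_div]
    exact div_le_div_of_nonneg_right h hV0.le
  -- Besides the inequality, this shows that equality for `μ` forces equality for the cones over the
  -- faces, which is what `heq` needs.
  have mono := oppositeConeSum_mono (by omega : 2 ≤ m + 1)
    (div_nonneg measureReal_nonneg hV0.le) (div_nonneg measureReal_nonneg hV0.le)
    (bound hu1) (bound hu2) hmain
  rw [add_div, sub_div]
  refine ⟨mono.1.trans hmain, fun h1 => ?_⟩
  have image_hull : ∀ {S T : Set (ℝ × (Fin m → ℝ))}, C = convexHull ℝ (S ∪ T) →
      (K : Set (EuclideanSpace ℝ (Fin (m + 1)))) =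
        convexHull ℝ (Ψ.symm '' S ∪ Ψ.symm '' T) := by
    intro S T h
    rw [hCK, h, ← Set.image_union]
    exact Ψ.symm.toLinearMap.image_convexHull _
  rcases heq (hmain.antisymm (h1.symm.le.trans mono.1)) with
    ⟨hpos, ⟨v, hv⟩, hh⟩ | ⟨hpos, z, hh⟩ | ⟨hpos, z, hh⟩
  · left
    obtain ⟨P, hP, hPb⟩ := LogMinkowski.exists_isHyperplaneBody u hΨu (Cc.slice α) (Cconv.slice α)
      hpos α
    -- The shift `v` between the slices is combined with the height difference `β - α`, which is the
    -- component along `u`.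
    refine ⟨P, α, Ψ.symm (β - α, v), hPb, ?_, ?_⟩
    · rw [← hΨu, Ψ.apply_symm_apply]
      exact (sub_pos.2 hlt).ne'
    · rw [image_hull hh, hP, hv]
      congr 2
      ext x
      constructor
      · rintro ⟨⟨t, _⟩, ⟨ht, ⟨y, hy, rfl⟩⟩, rfl⟩
        obtain rfl : t = β := ht
        refine ⟨_, ⟨(α, y), ⟨rfl, hy⟩, rfl⟩, ?_⟩
        simp only [← map_add, Prod.mk_add_mk, add_sub_cancel]
      · rintro ⟨_, ⟨⟨t, y⟩, ⟨ht, hy⟩, rfl⟩, rfl⟩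
        obtain rfl : t = α := ht
        refine ⟨(β, y + v), ⟨rfl, y, hy, rfl⟩, ?_⟩
        simp only [← map_add, Prod.mk_add_mk, add_sub_cancel]
  · right
    obtain ⟨P, hP, hPb⟩ := LogMinkowski.exists_isHyperplaneBody u hΨu (Cc.slice β) (Cconv.slice β)
      hpos β
    refine ⟨P, β, Ψ.symm (α, z), hPb, ?_, ?_⟩
    · rw [← hΨu, Ψ.apply_symm_apply]
      exact hlt.ne
    · rw [image_hull hh, hP, Set.image_singleton]
  · right
    obtain ⟨P, hP, hPb⟩ := LogMinkowski.exists_isHyperplaneBody u hΨu (Cc.slice α) (Cconv.slice α)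
      hpos α
    refine ⟨P, α, Ψ.symm (β, z), hPb, ?_, ?_⟩
    · rw [← hΨu, Ψ.apply_symm_apply]
      exact hlt.ne'
    · rw [image_hull hh, hP, Set.image_singleton]
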